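/- Let $\mathbb D$ be the open unit disc, $\mathbb T$ the unit circle, $\mathcal H(\mathbb D)$ the set of analytic functions on $\mathbb D$, and fix $M>\tfrac12$. For $\xi\in\mathbb T$ put $\Gamma(\xi)=\{z\in\mathbb D: |z-\xi|<M(1-|z|^2)\}$. Let $dA$ denote area measure on $\mathbb D$ and $|d\xi|$ arc length on $\mathbb T$. For $1\le p,q<\infty$ and measurable $f:\mathbb D\to\mathbb C$ define, with values in $[0,\infty]$, $$\rho_{p,q}(f)=\Big(\frac1{2\pi}\int_0^{2\pi}\Big(\int_0^1|f(re^{it})|^p\,dr\Big)^{q/p}dt\Big)^{1/q},\qquad \|f\|_{T_p^q(1)}=\Big(\int_{\mathbb T}\Big(\int_{\Gamma(\xi)}|f(z)|^p\,\frac{dA(z)}{1-|z|^2}\Big)^{q/p}|d\xi|\Big)^{1/q}.$$ Let $RM(p,q)=\{f\in\mathcal H(\mathbb D):\rho_{p,q}(f)<\infty\}$, let $T_p^q(1)$ be the set of measurable functions $f$ on $\mathbb D$ with $\|f\|_{T_p^q(1)}<\infty$, and let $AT_p^q(1)=T_p^q(1)\cap\mathcal H(\mathbb D)$. **Proposition 3.1.**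 Let $1\le p,q<\infty$. There is a constant $C>0$ depending only on $p$, $q$ and $M$ such that for every $f\in\mathcal H(\mathbb D)$: 1. $C^{-1}\|f\|_{T_p^q(1)}\le\rho_{p,q}(f)\le C\|f\|_{T_p^q(1)}$; 2. with $F(z)=f'(z)(1-|z|)$, $\;C^{-1}\|F\|_{T_p^q(1)}\le\rho_{p,q}(F)\le C\|F\|_{T_p^q(1)}$. In these inequalities the value $\infty$ is allowed, so that one side is finite if and only if the other is. In particular, $RM(p,q)=AT_p^q(1)$. -/

import Mathlib

namespace RadialTent

/-- The open unit disc of the complex plane. -/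
def disc : Set ℂ := Metric.ball 0 1

/-- The functions holomorphic on the unit disc (values off the disc play no role). -/
def holo : Set (ℂ → ℂ) := {f | DifferentiableOn ℂ f disc}

/-- The average radial integrability norm, with values in `[0, ∞]`, for finite exponents:
`ρ_{p,q}(f) = ((1 / 2π) ∫_0^{2π} (∫_0^1 |f (r e^{it})|^p dr)^{q/p} dt)^{1/q}`. -/
noncomputable def rho (p q : ℝ) (f : ℂ → ℂ) : ENNReal :=
  ((ENNReal.ofReal (2 * Real.pi))⁻¹ *
    ∫⁻ t in Set.Ioo (0 : ℝ) (2 * Real.pi),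
      (∫⁻ r in Set.Ioo (0 : ℝ) 1,
        ‖f ((r : ℂ) * Complex.exp ((t : ℂ) * Complex.I))‖ₑ ^ p) ^ (q / p)) ^ (1 / q)

/-- The space `RM(p,q)`, for finite exponents. -/
def RM (p q : ℝ) : Set (ℂ → ℂ) := {f | f ∈ holo ∧ rho p q f < ⊤}

/-- The non-tangential region `Γ_M(ξ)` of aperture `M` with vertex `ξ`. -/
def nontangential (M : ℝ) (ξ : ℂ) : Set ℂ := {z | z ∈ disc ∧ ‖z - ξ‖ < M * (1 - ‖z‖ ^ 2)}

/-- The tent space norm `‖f‖_{T_p^q(α)}`, with values in `[0, ∞]`, for finite exponents and the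
regions `Γ_M`:
`(∫_𝕋 (∫_{Γ_M(ξ)} |f z|^p dA(z) / (1 - |z|^2)^{2 - α})^{q/p} |dξ|)^{1/q}`,
where `dA` is area measure and `|dξ|` is arc length. -/
noncomputable def tentNorm (M p q α : ℝ) (f : ℂ → ℂ) : ENNReal :=
  (∫⁻ t in Set.Ioo (0 : ℝ) (2 * Real.pi),
    (∫⁻ z in nontangential M (Complex.exp ((t : ℂ) * Complex.I)),
      ‖f z‖ₑ ^ p / ENNReal.ofReal ((1 - ‖z‖ ^ 2) ^ (2 - α))) ^ (q / p)) ^ (1 / q)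

/-- The tent space `T_p^q(α)` of measurable functions on the disc, for finite exponents. -/
def tentSpace (M p q α : ℝ) : Set (ℂ → ℂ) :=
  {f | Measurable (disc.domRestrict f) ∧ tentNorm M p q α f < ⊤}

/-- The analytic tent space `AT_p^q(α) = T_p^q(α) ∩ H(𝔻)`. -/
def analyticTentSpace (M p q α : ℝ) : Set (ℂ → ℂ) := tentSpace M p q α ∩ holo

/-- The function `z ↦ f'(z) (1 - |z|)`. -/
noncomputable def weightedDeriv (f : ℂ → ℂ) : ℂ → ℂ :=
  fun z => deriv f z * ((1 - ‖z‖ : ℝ) : ℂ)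

end RadialTent

/-!
For a holomorphic `g` and `κ ∈ {0, 1}` put `u z = |g z| (1 - |z|)^κ`; the values `κ = 0` and
`κ = 1` (with `g = f'`) give the two pairs of inequalities. All that is used of `u` is the
sub-mean-value property of `u^{1/2}` on Whitney discs `|w - z| < δ (1 - |z|)`
(`exists_weightedSize_rpow_half_le`) and, near the origin, the maximum principle
(`exists_norm_eq_weightedSize_le`).

*Radial by conical.* For `r` close to `1` a small Whitney disc about `r ξ` lies in `Γ_M(ξ)`, because
`M > 1/2`. Averaging `u^p` over such discs bounds the part of `∫ u(r ξ)^p dr` near the boundary by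
the conical integral with the same vertex (`radialInt_tail_le`). If `M < 1` the region omits a
neighbourhood of the origin, so the remaining part is compared, by the maximum principle, with one
point `w₀` of a circle close to the boundary, which is seen from an arc of vertices of length
bounded below.

*Conical by radial.* Let `h_k(θ)` be the integral of `u(r e^{iθ})^{1/2}` over `1 - r ≈ 2^{-k}`. The
sub-mean-value property bounds `u^{1/2}` on `Γ_M(e^{it}) ∩ {1 - |z| ≈ 2^{-k}}` by `2^k` times the
average of `h_k` over an arc of length about `2^{-k}` around `t`, and by the one-third trick this
arc may be taken from one of two dyadic grids (`setLIntegral_arc_le`). So the conical integral is at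
most `∑ k, 2^{(2p-1)k} (E_k h_k)^{2p}` with dyadic averages `E_k` (`exists_conicalInt_le`), while
Jensen's inequality gives `∑ k, 2^{(2p-1)k} h_k^{2p} ≲ ∫ u(r e^{it})^p dr`
(`tsum_layerSeq_rpow_le`). What remains is the boundedness of `(h_k) ↦ (E_k h_k)` on `L^b(ℓ^a)` with
`a = 2p`, `b = 2q` (`exists_lintegral_tsum_kernelOp_rpow_rpow_le`). No maximal function is needed: if
`a ≤ b` it follows from Jensen's inequality and the dual Doob inequality
`∫ (∑ E_k h_k)^c ≤ c^c ∫ (∑ h_k)^c` for `c = b / a`, and if `1 < b < a` by duality, as `E_k` is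
self-adjoint. The exponent `1/2` is there to make `b > 1` also when `q = 1`.
-/

namespace RadialTent

open MeasureTheory ENNReal

/-! ### Inequalities for powers in `[0, ∞]` -/

/-- Jensen's inequality for the power `a ≥ 1` and a measure of arbitrary mass. -/
theorem lintegral_rpow_le_measure_rpow_mul {X : Type*} [MeasurableSpace X] (ν : Measure X)
    {a : ℝ} (ha : 1 ≤ a) {φ : X → ℝ≥0∞} (hφ : AEMeasurable φ ν) :
    (∫⁻ x, φ x ∂ν) ^ a ≤ ν Set.univ ^ (a - 1) * ∫⁻ x, φ x ^ a ∂ν := by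
  rcases ha.eq_or_lt with rfl | ha
  · simp
  have hpq := Real.HolderConjugate.conjExponent ha
  have h := ENNReal.lintegral_mul_le_Lp_mul_Lq ν hpq hφ (aemeasurable_const (b := (1 : ℝ≥0∞)))
  simp only [Pi.mul_apply, mul_one, ENNReal.one_rpow, lintegral_one] at h
  refine (ENNReal.rpow_le_rpow h (by linarith)).trans (le_of_eq ?_)
  rw [ENNReal.mul_rpow_of_nonneg _ _ (by linarith), ← ENNReal.rpow_mul, ← ENNReal.rpow_mul,
    mul_comm]
  congr 2
  · rw [Real.conjExponent]; field_simp
  · rw [one_div, inv_mul_cancel₀ (by linarith), ENNReal.rpow_one]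

/-- The tangent line inequality for `x ↦ x^c`, a form of Bernoulli's inequality. -/
theorem add_rpow_le_rpow_add_mul (A B : ℝ≥0∞) {c : ℝ} (hc : 1 ≤ c) :
    (A + B) ^ c ≤ A ^ c + ENNReal.ofReal c * (B * (A + B) ^ (c - 1)) := by
  rcases hc.eq_or_lt with rfl | hc
  · simp
  have hc' : ENNReal.ofReal c ≠ 0 := by simp; linarith
  by_cases hA : A = ⊤
  · simp [hA, ENNReal.top_rpow_of_pos (show 0 < c by linarith)]
  by_cases hB : B = ⊤
  · simp [hB, ENNReal.top_rpow_of_pos (show 0 < c - 1 by linarith), hc']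
  lift A to NNReal using hA
  lift B to NNReal using hB
  by_cases h0 : (A : ℝ) + B = 0
  · have h1 : A = 0 := by rw [← NNReal.coe_inj]; push_cast; linarith [A.coe_nonneg, B.coe_nonneg]
    have h2 : B = 0 := by rw [← NNReal.coe_inj]; push_cast; linarith [A.coe_nonneg, B.coe_nonneg]
    simp [h1, h2, ENNReal.zero_rpow_of_pos (show 0 < c by linarith)]
  have hS : 0 < (A : ℝ) + B := lt_of_le_of_ne (by positivity) (Ne.symm h0)
  have key : ((A : ℝ) + B) ^ c ≤ (A : ℝ) ^ c + c * (B * ((A : ℝ) + B) ^ (c - 1)) := by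
    have hb := one_add_mul_self_le_rpow_one_add (s := (A : ℝ) / (A + B) - 1)
      (by have : (0 : ℝ) ≤ (A : ℝ) / (A + B) := by positivity
          linarith) hc.le
    rw [add_sub_cancel, Real.div_rpow (by positivity) hS.le, le_div_iff₀ (by positivity)] at hb
    have e : ((A : ℝ) + B) ^ c = ((A : ℝ) + B) ^ (c - 1) * (A + B) := by
      rw [Real.rpow_sub_one h0]; field_simp
    have e2 : (1 + c * ((A : ℝ) / (A + B) - 1)) * ((A : ℝ) + B) ^ c
        = ((A : ℝ) + B) ^ c - c * (B * ((A : ℝ) + B) ^ (c - 1)) := by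
      rw [e]; field_simp; ring
    linarith
  rw [ENNReal.ofReal, ← ENNReal.coe_add, ← ENNReal.coe_rpow_of_nonneg _ (by linarith),
    ← ENNReal.coe_rpow_of_nonneg _ (by linarith), ← ENNReal.coe_rpow_of_nonneg _ (by linarith),
    ← ENNReal.coe_mul, ← ENNReal.coe_mul, ← ENNReal.coe_add, ENNReal.coe_le_coe,
    ← NNReal.coe_le_coe]
  push_cast
  rw [Real.coe_toNNReal _ (by linarith)]
  exact key

/-- If `x ≤ C y^{1/s} x^{1/s'}` with conjugate exponents and `x` is finite, then `x ≤ C^s y`. -/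
theorem le_of_le_mul_rpow_mul_rpow {x y C : ℝ≥0∞} {s s' : ℝ} (h : s.HolderConjugate s')
    (hx : x ≠ ⊤) (hle : x ≤ C * (y ^ (1 / s) * x ^ (1 / s'))) : x ≤ C ^ s * y := by
  rcases eq_or_ne x 0 with rfl | h0
  · simp
  have hs := h.pos
  have e : x = x ^ (1 / s) * x ^ (1 / s') := by
    rw [← ENNReal.rpow_add _ _ h0 hx, one_div, one_div, h.inv_add_inv_eq_one, ENNReal.rpow_one]
  have h1 : x ^ (1 / s) ≤ C * y ^ (1 / s) := by
    have hn0 : x ^ (1 / s') ≠ 0 := by simp [h0, hx]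
    have hnt : x ^ (1 / s') ≠ ⊤ := by simp [h0, hx]
    rw [← mul_assoc] at hle
    nth_rewrite 1 [e] at hle
    exact (ENNReal.mul_le_mul_iff_left hn0 hnt).1 hle
  have h2 := ENNReal.rpow_le_rpow h1 hs.le
  rwa [ENNReal.mul_rpow_of_nonneg _ _ hs.le, ← ENNReal.rpow_mul, ← ENNReal.rpow_mul, one_div,
    inv_mul_cancel₀ hs.ne', ENNReal.rpow_one, ENNReal.rpow_one] at h2

theorem add_rpow_le_two_rpow_mul (A B : ℝ≥0∞) {s : ℝ} (hs : 0 ≤ s) :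
    (A + B) ^ s ≤ 2 ^ s * (A ^ s + B ^ s) := by
  wlog h : A ≤ B generalizing A B
  · rw [add_comm A B, add_comm (A ^ s)]
    exact this B A (le_of_not_ge h)
  calc (A + B) ^ s ≤ (2 * B) ^ s := by
        refine ENNReal.rpow_le_rpow ?_ hs
        rw [two_mul]; gcongr
    _ = 2 ^ s * B ^ s := ENNReal.mul_rpow_of_nonneg _ _ hs
    _ ≤ _ := by gcongr; exact le_add_self

/-! ### Vector-valued inequalities for averaging operators -/

/-- The integral operator with kernel `N`. -/
noncomputable def kernelOp {X : Type*} [MeasurableSpace X] (μ : Measure X)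
    (N : X → X → ℝ≥0∞) (h : X → ℝ≥0∞) (x : X) : ℝ≥0∞ := ∫⁻ y, N x y * h y ∂μ

/-- A sequence of symmetric sub-Markov kernels which behaves like the conditional expectations
onto an increasing sequence of partitions: points linked by a fine kernel are indistinguishable
for the coarser ones. -/
structure IsAveraging {X : Type*} [MeasurableSpace X] (μ : Measure X)
    (N : ℕ → X → X → ℝ≥0∞) : Prop where
  measurable : ∀ k, Measurable (Function.uncurry (N k))
  symm : ∀ k x y, N k x y = N k y x
  lintegral_le_one : ∀ k x, ∫⁻ y, N k x y ∂μ ≤ 1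
  coherent : ∀ j k x y, j ≤ k → N k x y ≠ 0 → N j x = N j y

section Kernel

variable {X : Type*} [MeasurableSpace X] {μ : Measure X} {N : ℕ → X → X → ℝ≥0∞}

theorem IsAveraging.measurable_kernelOp [SFinite μ] (hN : IsAveraging μ N) (k : ℕ)
    {h : X → ℝ≥0∞} (hh : Measurable h) : Measurable (kernelOp μ (N k) h) :=
  ((hN.measurable k).mul (hh.comp measurable_snd)).lintegral_prod_right'

theorem IsAveraging.measurable_right (hN : IsAveraging μ N) (k : ℕ) (x : X) :
    Measurable (N k x) :=
  (hN.measurable k).comp measurable_prodMk_left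

theorem IsAveraging.lintegral_kernelOp_mul [SFinite μ] (hN : IsAveraging μ N) (k : ℕ)
    {h g : X → ℝ≥0∞} (hh : Measurable h) (hg : Measurable g) :
    ∫⁻ x, kernelOp μ (N k) h x * g x ∂μ = ∫⁻ x, h x * kernelOp μ (N k) g x ∂μ := by
  have e1 : ∀ x, kernelOp μ (N k) h x * g x = ∫⁻ y, N k x y * h y * g x ∂μ := fun x =>
    (lintegral_mul_const _ ((hN.measurable_right k x).mul hh)).symm
  have e2 : ∀ x, h x * kernelOp μ (N k) g x = ∫⁻ y, h x * (N k x y * g y) ∂μ := fun x =>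
    (lintegral_const_mul _ ((hN.measurable_right k x).mul hg)).symm
  simp_rw [e1, e2]
  rw [lintegral_lintegral_swap]
  · refine lintegral_congr fun x => lintegral_congr fun y => ?_
    rw [hN.symm k y x]; ring
  · exact (((hN.measurable k).mul (hh.comp measurable_snd)).mul
      (hg.comp measurable_fst)).aemeasurable

theorem IsAveraging.lintegral_kernelOp_le [SFinite μ] (hN : IsAveraging μ N) (k : ℕ)
    {h : X → ℝ≥0∞} (hh : Measurable h) :
    ∫⁻ x, kernelOp μ (N k) h x ∂μ ≤ ∫⁻ x, h x ∂μ := by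
  have := hN.lintegral_kernelOp_mul k hh (measurable_const (a := (1 : ℝ≥0∞)))
  simp only [mul_one] at this
  rw [this]
  refine lintegral_mono fun x => mul_le_of_le_one_right' ?_
  simpa [kernelOp] using hN.lintegral_le_one k x

/-- Jensen's inequality for the averages. -/
theorem IsAveraging.kernelOp_rpow_le (hN : IsAveraging μ N) (k : ℕ)
    {h : X → ℝ≥0∞} (hh : Measurable h) {a : ℝ} (ha : 1 ≤ a) (x : X) :
    kernelOp μ (N k) h x ^ a ≤ kernelOp μ (N k) (fun y => h y ^ a) x := by
  have e : ∀ f : X → ℝ≥0∞, Measurable f →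
      kernelOp μ (N k) f x = ∫⁻ y, f y ∂(μ.withDensity (N k x)) := fun f hf =>
    (lintegral_withDensity_eq_lintegral_mul μ (hN.measurable_right k x) hf).symm
  rw [e h hh, e _ (hh.pow_const a)]
  refine (lintegral_rpow_le_measure_rpow_mul _ ha hh.aemeasurable).trans
    (mul_le_of_le_one_left' ?_)
  refine ENNReal.rpow_le_one ?_ (by linarith)
  rw [withDensity_apply _ MeasurableSet.univ, Measure.restrict_univ]
  exact hN.lintegral_le_one k x

theorem IsAveraging.kernelOp_congr (hN : IsAveraging μ N) {j k : ℕ} (hjk : j ≤ k) {x y : X}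
    (hxy : N k x y ≠ 0) (h : X → ℝ≥0∞) : kernelOp μ (N j) h x = kernelOp μ (N j) h y := by
  simp only [kernelOp, hN.coherent j k x y hjk hxy]

/-- Summation form of the tangent line inequality, `v_k` being the increments of the sum. -/
theorem sum_rpow_le_sum_mul_partial_sum_rpow (v : ℕ → ℝ≥0∞) {c : ℝ} (hc : 1 ≤ c) (n : ℕ) :
    (∑ k ∈ Finset.range n, v k) ^ c ≤ ENNReal.ofReal c *
      ∑ k ∈ Finset.range n, v k * (∑ j ∈ Finset.range (k + 1), v j) ^ (c - 1) := by
  induction n with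
  | zero => simp [ENNReal.zero_rpow_of_pos (show 0 < c by linarith)]
  | succ n ih =>
    rw [Finset.sum_range_succ (n := n), Finset.sum_range_succ (n := n), mul_add]
    refine (add_rpow_le_rpow_add_mul _ _ hc).trans (add_le_add ih ?_)
    rw [Finset.sum_range_succ (n := n)]

/-- Crude finiteness: finitely many averages are controlled with a constant depending on their
number. -/
theorem IsAveraging.lintegral_sum_kernelOp_rpow_ne_top [SFinite μ] (hN : IsAveraging μ N)
    {h : ℕ → X → ℝ≥0∞} (hh : ∀ k, Measurable (h k)) {c : ℝ} (hc : 1 ≤ c) (n : ℕ)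
    (hfin : ∀ k < n, ∫⁻ x, h k x ^ c ∂μ ≠ ⊤) :
    ∫⁻ x, (∑ k ∈ Finset.range n, kernelOp μ (N k) (h k) x) ^ c ∂μ ≠ ⊤ := by
  refine ne_top_of_le_ne_top (b := (Finset.card (Finset.range n) : ℝ≥0∞) ^ (c - 1) *
    ∑ k ∈ Finset.range n, ∫⁻ x, h k x ^ c ∂μ) ?_ ?_
  · refine ENNReal.mul_ne_top (by simp; intro _; linarith) ?_
    exact (ENNReal.sum_lt_top.2 fun k hk =>
      (hfin k (Finset.mem_range.1 hk)).lt_top).ne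
  · calc _ ≤ ∫⁻ x, (Finset.card (Finset.range n) : ℝ≥0∞) ^ (c - 1) *
          ∑ k ∈ Finset.range n, kernelOp μ (N k) (fun y => h k y ^ c) x ∂μ := by
          refine lintegral_mono fun x => ?_
          refine (ENNReal.rpow_sum_le_const_mul_sum_rpow _ _ hc).trans ?_
          gcongr with k hk
          exact hN.kernelOp_rpow_le k (hh k) hc x
      _ = (Finset.card (Finset.range n) : ℝ≥0∞) ^ (c - 1) *
          ∑ k ∈ Finset.range n, ∫⁻ x, kernelOp μ (N k) (fun y => h k y ^ c) x ∂μ := by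
          rw [lintegral_const_mul, lintegral_finsetSum]
          · exact fun k _ => hN.measurable_kernelOp k ((hh k).pow_const c)
          · exact Finset.measurable_sum _
              fun k _ => hN.measurable_kernelOp k ((hh k).pow_const c)
      _ ≤ _ := by
          refine mul_le_mul_right (Finset.sum_le_sum fun k _ => ?_) _
          exact hN.lintegral_kernelOp_le k ((hh k).pow_const c)

/-- The dual Doob inequality. With `S_k = ∑_{j ≤ k} E_j h_j` one has `S_n^c ≤ c ∑ (E_k h_k) S_k^{c-1}`,
and `∫ (E_k h_k) S_k^{c-1} = ∫ h_k E_k (S_k^{c-1}) ≤ ∫ h_k S_n^{c-1}`, so that Hölder's inequality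
bounds `∫ S_n^c` by `c ‖∑ h_k‖_c (∫ S_n^c)^{1 - 1/c}`. -/
theorem IsAveraging.lintegral_sum_kernelOp_rpow_le [SFinite μ] (hN : IsAveraging μ N)
    {h : ℕ → X → ℝ≥0∞} (hh : ∀ k, Measurable (h k)) {c : ℝ} (hc : 1 ≤ c) (n : ℕ) :
    ∫⁻ x, (∑ k ∈ Finset.range n, kernelOp μ (N k) (h k) x) ^ c ∂μ ≤
      ENNReal.ofReal c ^ c * ∫⁻ x, (∑ k ∈ Finset.range n, h k x) ^ c ∂μ := by
  have hc0 : 0 < c := by linarith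
  by_cases htop : ∫⁻ x, (∑ k ∈ Finset.range n, h k x) ^ c ∂μ = ⊤
  · rw [htop, ENNReal.mul_top]
    · exact le_top
    · simp [hc0]
  have hfin : ∫⁻ x, (∑ k ∈ Finset.range n, kernelOp μ (N k) (h k) x) ^ c ∂μ ≠ ⊤ := by
    refine hN.lintegral_sum_kernelOp_rpow_ne_top hh hc n fun k hk => ?_
    refine ne_top_of_le_ne_top htop (lintegral_mono fun x => ?_)
    exact ENNReal.rpow_le_rpow
      (Finset.single_le_sum (f := fun k => h k x) (fun _ _ => zero_le)
        (Finset.mem_range.2 hk)) hc0.le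
  set S : ℕ → X → ℝ≥0∞ := fun n x => ∑ k ∈ Finset.range n, kernelOp μ (N k) (h k) x with hS
  have hSm : ∀ n, Measurable (S n) := fun n =>
    Finset.measurable_sum _ fun k _ => hN.measurable_kernelOp k (hh k)
  have hvm : ∀ k, Measurable (kernelOp μ (N k) (h k)) := fun k => hN.measurable_kernelOp k (hh k)
  -- Partial sums up to level `k` are constant on the cells of level `k`.
  have hconst : ∀ k < n, ∀ x, kernelOp μ (N k) (fun y => S (k + 1) y ^ (c - 1)) x ≤
      S n x ^ (c - 1) := by
    intro k hk x
    calc kernelOp μ (N k) (fun y => S (k + 1) y ^ (c - 1)) x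
        = ∫⁻ y, N k x y * S (k + 1) x ^ (c - 1) ∂μ := by
          refine lintegral_congr fun y => ?_
          by_cases h0 : N k x y = 0
          · simp [h0]
          · have e : S (k + 1) y = S (k + 1) x := Finset.sum_congr rfl fun j hj =>
              (hN.kernelOp_congr (Nat.lt_succ_iff.1 (Finset.mem_range.1 hj)) h0 _).symm
            simp only [e]
      _ = (∫⁻ y, N k x y ∂μ) * S (k + 1) x ^ (c - 1) :=
          lintegral_mul_const _ (hN.measurable_right k x)
      _ ≤ 1 * S n x ^ (c - 1) := by
          refine mul_le_mul' (hN.lintegral_le_one k x) (ENNReal.rpow_le_rpow ?_ (by linarith))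
          exact Finset.sum_le_sum_of_subset (Finset.range_mono hk)
      _ = _ := one_mul _
  have hmain : ∫⁻ x, S n x ^ c ∂μ ≤ ENNReal.ofReal c *
      ∫⁻ x, (∑ k ∈ Finset.range n, h k x) * S n x ^ (c - 1) ∂μ := by
    calc ∫⁻ x, S n x ^ c ∂μ
        ≤ ∫⁻ x, ENNReal.ofReal c * ∑ k ∈ Finset.range n,
            kernelOp μ (N k) (h k) x * S (k + 1) x ^ (c - 1) ∂μ :=
          lintegral_mono fun x => sum_rpow_le_sum_mul_partial_sum_rpow _ hc n
      _ = ENNReal.ofReal c * ∑ k ∈ Finset.range n,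
            ∫⁻ x, kernelOp μ (N k) (h k) x * S (k + 1) x ^ (c - 1) ∂μ := by
          rw [lintegral_const_mul, lintegral_finsetSum]
          · exact fun k _ => (hvm k).mul ((hSm _).pow_const _)
          · exact Finset.measurable_sum _ fun k _ => (hvm k).mul ((hSm _).pow_const _)
      _ ≤ ENNReal.ofReal c * ∑ k ∈ Finset.range n, ∫⁻ x, h k x * S n x ^ (c - 1) ∂μ := by
          refine mul_le_mul_right (Finset.sum_le_sum fun k hk => ?_) _
          rw [hN.lintegral_kernelOp_mul k (hh k) ((hSm _).pow_const _)]
          exact lintegral_mono fun x =>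
            mul_le_mul_right (hconst k (Finset.mem_range.1 hk) x) _
      _ = _ := by
          simp_rw [Finset.sum_mul]
          rw [lintegral_finsetSum]
          exact fun k _ => (hh k).mul ((hSm _).pow_const _)
  rcases hc.eq_or_lt with rfl | hc1
  · simpa using hmain
  have hpq := Real.HolderConjugate.conjExponent hc1
  refine le_of_le_mul_rpow_mul_rpow hpq hfin (hmain.trans ?_)
  gcongr
  refine (ENNReal.lintegral_mul_le_Lp_mul_Lq μ hpq
    (Finset.measurable_sum _ fun k _ => hh k).aemeasurable
    ((hSm n).pow_const _).aemeasurable).trans (le_of_eq ?_)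
  congr 3
  ext x
  rw [← ENNReal.rpow_mul, Real.conjExponent, mul_div_cancel₀ _ (by linarith)]

/-- Vector-valued bound in `L^b(ℓ^a)` for `1 ≤ a ≤ b`. -/
theorem IsAveraging.lintegral_sum_kernelOp_rpow_rpow_le_of_le [SFinite μ] (hN : IsAveraging μ N)
    {h : ℕ → X → ℝ≥0∞} (hh : ∀ k, Measurable (h k)) {a b : ℝ} (ha : 1 ≤ a) (hab : a ≤ b)
    (n : ℕ) :
    ∫⁻ x, (∑ k ∈ Finset.range n, kernelOp μ (N k) (h k) x ^ a) ^ (b / a) ∂μ ≤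
      ENNReal.ofReal (b / a) ^ (b / a) *
        ∫⁻ x, (∑ k ∈ Finset.range n, h k x ^ a) ^ (b / a) ∂μ := by
  have hba : 1 ≤ b / a := (one_le_div (by linarith)).2 hab
  refine le_trans (lintegral_mono fun x => ?_)
    (hN.lintegral_sum_kernelOp_rpow_le (fun k => (hh k).pow_const a) hba n)
  gcongr with k hk
  exact hN.kernelOp_rpow_le k (hh k) ha x

/-- Vector-valued bound in `L^b(ℓ^a)` for `1 < b < a`, by duality with the case of the conjugate
exponents. -/
theorem IsAveraging.lintegral_sum_kernelOp_rpow_rpow_le_of_lt [SFinite μ] (hN : IsAveraging μ N)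
    {h : ℕ → X → ℝ≥0∞} (hh : ∀ k, Measurable (h k)) {a b : ℝ} (hb : 1 < b) (hab : b < a)
    (n : ℕ) :
    ∫⁻ x, (∑ k ∈ Finset.range n, kernelOp μ (N k) (h k) x ^ a) ^ (b / a) ∂μ ≤
      ((ENNReal.ofReal (b.conjExponent / a.conjExponent) ^ (b.conjExponent / a.conjExponent)) ^
        (1 / b.conjExponent)) ^ b *
        ∫⁻ x, (∑ k ∈ Finset.range n, h k x ^ a) ^ (b / a) ∂μ := by
  have ha : 1 < a := hb.trans hab
  have hpa := Real.HolderConjugate.conjExponent ha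
  have hpb := Real.HolderConjugate.conjExponent hb
  have hab' : a.conjExponent ≤ b.conjExponent := by
    rw [Real.conjExponent, Real.conjExponent, div_le_div_iff₀ (by linarith) (by linarith)]
    nlinarith
  set a' := a.conjExponent with ha'
  set b' := b.conjExponent with hb'
  set D : ℝ≥0∞ := ENNReal.ofReal (b' / a') ^ (b' / a') with hD
  set v : ℕ → X → ℝ≥0∞ := fun k x => kernelOp μ (N k) (h k) x with hv
  have hvm : ∀ k, Measurable (v k) := fun k => hN.measurable_kernelOp k (hh k)
  set P : X → ℝ≥0∞ := fun x => ∑ k ∈ Finset.range n, v k x ^ a with hP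
  have hPm : Measurable P := Finset.measurable_sum _ fun k _ => (hvm k).pow_const a
  set Q : X → ℝ≥0∞ := fun x => ∑ k ∈ Finset.range n, h k x ^ a with hQ
  have hQm : Measurable Q := Finset.measurable_sum _ fun k _ => (hh k).pow_const a
  change ∫⁻ x, P x ^ (b / a) ∂μ ≤ (D ^ (1 / b')) ^ b * ∫⁻ x, Q x ^ (b / a) ∂μ
  have hba0 : 0 < b / a := by have := hpb.pos; have := hpa.pos; positivity
  by_cases htop : ∫⁻ x, Q x ^ (b / a) ∂μ = ⊤
  · rw [htop, ENNReal.mul_top]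
    · exact le_top
    · have h1 : 0 < b' / a' := div_pos hpb.symm.pos hpa.symm.pos
      have h2 : D ≠ 0 := by
        rw [hD]; exact (ENNReal.rpow_pos (ENNReal.ofReal_pos.2 h1) ENNReal.ofReal_ne_top).ne'
      have h3 : D ≠ ⊤ := ENNReal.rpow_ne_top_of_nonneg h1.le ENNReal.ofReal_ne_top
      have h4 : D ^ (1 / b') ≠ 0 := (ENNReal.rpow_pos (pos_iff_ne_zero.2 h2) h3).ne'
      have h5 : D ^ (1 / b') ≠ ⊤ :=
        ENNReal.rpow_ne_top_of_nonneg (one_div_nonneg.2 hpb.symm.pos.le) h3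
      exact (ENNReal.rpow_pos (pos_iff_ne_zero.2 h4) h5).ne'
  have hfin : ∫⁻ x, P x ^ (b / a) ∂μ ≠ ⊤ := by
    have h1 : ∀ x, P x ^ (b / a) ≤ (∑ k ∈ Finset.range n, v k x) ^ b := by
      intro x
      have h2 : P x ≤ (∑ k ∈ Finset.range n, v k x) ^ a := by
        have : ∀ m, ∑ k ∈ Finset.range m, v k x ^ a ≤ (∑ k ∈ Finset.range m, v k x) ^ a := by
          intro m
          induction m with
          | zero => simp
          | succ m ih =>
            rw [Finset.sum_range_succ, Finset.sum_range_succ]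
            exact (add_le_add_left ih _).trans (ENNReal.add_rpow_le_rpow_add _ _ ha.le)
        exact this n
      refine (ENNReal.rpow_le_rpow h2 hba0.le).trans (le_of_eq ?_)
      rw [← ENNReal.rpow_mul, mul_div_cancel₀ _ (by linarith)]
    refine ne_top_of_le_ne_top ?_ (lintegral_mono h1)
    refine hN.lintegral_sum_kernelOp_rpow_ne_top hh hb.le n fun k hk => ?_
    refine ne_top_of_le_ne_top htop (lintegral_mono fun x => ?_)
    have h2 : h k x ^ a ≤ Q x :=
      Finset.single_le_sum (f := fun k => h k x ^ a) (fun _ _ => zero_le) (Finset.mem_range.2 hk)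
    refine le_trans (le_of_eq ?_) (ENNReal.rpow_le_rpow h2 hba0.le)
    rw [← ENNReal.rpow_mul, mul_div_cancel₀ _ (by linarith)]
  -- The dual sequence; where `P` vanishes or is infinite it is zero, by `0 * ⊤ = 0`.
  set g : ℕ → X → ℝ≥0∞ := fun k x => v k x ^ (a - 1) * P x ^ ((b - a) / a) with hg
  have hgm : ∀ k, Measurable (g k) := fun k =>
    ((hvm k).pow_const _).mul (hPm.pow_const _)
  have hPtop : ∀ᵐ x ∂μ, P x ≠ ⊤ := by
    filter_upwards [ae_lt_top (hPm.pow_const (b / a)) hfin] with x hx h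
    rw [h, ENNReal.top_rpow_of_pos hba0] at hx
    exact lt_irrefl _ hx
  have hpt : ∀ᵐ x ∂μ, P x ^ (b / a) ≤ ∑ k ∈ Finset.range n, v k x * g k x := by
    filter_upwards [hPtop] with x hx
    have e : ∑ k ∈ Finset.range n, v k x * g k x = P x * P x ^ ((b - a) / a) := by
      rw [hP, Finset.sum_mul]
      refine Finset.sum_congr rfl fun k _ => ?_
      rw [hg]
      have : v k x ^ a = v k x * v k x ^ (a - 1) := by
        conv_rhs => enter [1]; rw [← ENNReal.rpow_one (v k x)]
        rw [← ENNReal.rpow_add_of_nonneg _ _ zero_le_one (by linarith), add_sub_cancel]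
      rw [this]; ring
    rw [e]
    rcases eq_or_ne (P x) 0 with h0 | h0
    · rw [h0, ENNReal.zero_rpow_of_pos hba0]; exact zero_le
    · nth_rewrite 2 [← ENNReal.rpow_one (P x)]
      rw [← ENNReal.rpow_add _ _ h0 hx]
      refine le_of_eq ?_
      congr 1; field_simp; ring
  have hgsum : ∀ x, (∑ k ∈ Finset.range n, g k x ^ a') ^ (b' / a') ≤ P x ^ (b / a) := by
    intro x
    have e : ∑ k ∈ Finset.range n, g k x ^ a' = P x * P x ^ ((b - a) / (a - 1)) := by
      rw [hP, Finset.sum_mul]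
      refine Finset.sum_congr rfl fun k _ => ?_
      rw [hg, ENNReal.mul_rpow_of_nonneg _ _ hpa.symm.nonneg, ← ENNReal.rpow_mul,
        ← ENNReal.rpow_mul, ha', Real.conjExponent]
      have := sub_pos.2 ha
      congr 2
      · field_simp
      · field_simp
    have hq : 0 < b' / a' := div_pos hpb.symm.pos hpa.symm.pos
    rw [e]
    rcases eq_or_ne (P x) 0 with h0 | h0
    · rw [h0, zero_mul, ENNReal.zero_rpow_of_pos hq]; exact zero_le
    rcases eq_or_ne (P x) ⊤ with h1 | h1
    · rw [h1, ENNReal.top_rpow_of_pos hba0]; exact le_top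
    · nth_rewrite 1 [← ENNReal.rpow_one (P x)]
      rw [← ENNReal.rpow_add _ _ h0 h1, ← ENNReal.rpow_mul]
      refine le_of_eq ?_
      have := sub_pos.2 ha
      have := sub_pos.2 hb
      congr 1
      rw [ha', hb', Real.conjExponent, Real.conjExponent]; field_simp; ring
  have hW := hN.lintegral_sum_kernelOp_rpow_rpow_le_of_le hgm hpa.symm.lt.le hab' n
  refine le_of_le_mul_rpow_mul_rpow hpb hfin ?_
  calc ∫⁻ x, P x ^ (b / a) ∂μ
      ≤ ∫⁻ x, ∑ k ∈ Finset.range n, v k x * g k x ∂μ := lintegral_mono_ae hpt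
    _ = ∫⁻ x, ∑ k ∈ Finset.range n, h k x * kernelOp μ (N k) (g k) x ∂μ := by
        rw [lintegral_finsetSum, lintegral_finsetSum]
        rotate_left
        · exact fun k _ => (hh k).mul (hN.measurable_kernelOp k (hgm k))
        · exact fun k _ => (hvm k).mul (hgm k)
        exact Finset.sum_congr rfl fun k _ => hN.lintegral_kernelOp_mul k (hh k) (hgm k)
    _ ≤ ∫⁻ x, Q x ^ (1 / a) *
          (∑ k ∈ Finset.range n, kernelOp μ (N k) (g k) x ^ a') ^ (1 / a') ∂μ :=
        lintegral_mono fun x => ENNReal.inner_le_Lp_mul_Lq _ _ _ hpa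
    _ ≤ (∫⁻ x, (Q x ^ (1 / a)) ^ b ∂μ) ^ (1 / b) *
          (∫⁻ x, ((∑ k ∈ Finset.range n, kernelOp μ (N k) (g k) x ^ a') ^ (1 / a')) ^ b' ∂μ) ^
            (1 / b') :=
        ENNReal.lintegral_mul_le_Lp_mul_Lq μ hpb (hQm.pow_const _).aemeasurable
          ((Finset.measurable_sum _ fun k _ =>
            (hN.measurable_kernelOp k (hgm k)).pow_const a').pow_const _).aemeasurable
    _ ≤ (∫⁻ x, Q x ^ (b / a) ∂μ) ^ (1 / b) * (D * ∫⁻ x, P x ^ (b / a) ∂μ) ^ (1 / b') := by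
        refine mul_le_mul' (le_of_eq ?_) (ENNReal.rpow_le_rpow ?_ hpb.symm.one_div_nonneg)
        · simp_rw [← ENNReal.rpow_mul]
          congr 3; ext x; congr 1; ring
        · refine le_trans (le_of_eq ?_) (hW.trans (mul_le_mul_right (lintegral_mono hgsum) _))
          simp_rw [← ENNReal.rpow_mul]
          congr 1; ext x; congr 1; ring
    _ = _ := by
        rw [ENNReal.mul_rpow_of_nonneg _ _ hpb.symm.one_div_nonneg]; ring

/-- Vector-valued bound in `L^b(ℓ^a)` for infinite sequences of averages. The constant depends on
the exponents only. -/
theorem exists_lintegral_tsum_kernelOp_rpow_rpow_le {a b : ℝ} (ha : 1 ≤ a) (hb : 1 < b) :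
    ∃ C : NNReal, ∀ {X : Type} [MeasurableSpace X] {μ : Measure X} [SFinite μ]
      {N : ℕ → X → X → ℝ≥0∞}, IsAveraging μ N → ∀ h : ℕ → X → ℝ≥0∞, (∀ k, Measurable (h k)) →
      ∫⁻ x, (∑' k, kernelOp μ (N k) (h k) x ^ a) ^ (b / a) ∂μ ≤
        C * ∫⁻ x, (∑' k, h k x ^ a) ^ (b / a) ∂μ := by
  have hba0 : 0 < b / a := div_pos (by linarith) (by linarith)
  obtain ⟨C, hC⟩ : ∃ C : NNReal, ∀ {X : Type} [MeasurableSpace X] {μ : Measure X} [SFinite μ]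
      {N : ℕ → X → X → ℝ≥0∞}, IsAveraging μ N → ∀ h : ℕ → X → ℝ≥0∞, (∀ k, Measurable (h k)) →
      ∀ n, ∫⁻ x, (∑ k ∈ Finset.range n, kernelOp μ (N k) (h k) x ^ a) ^ (b / a) ∂μ ≤
        C * ∫⁻ x, (∑ k ∈ Finset.range n, h k x ^ a) ^ (b / a) ∂μ := by
    rcases le_or_gt a b with hab | hab
    · refine ⟨(ENNReal.ofReal (b / a) ^ (b / a)).toNNReal, ?_⟩
      intro X _ μ _ N hN h hh n
      rw [ENNReal.coe_toNNReal (ENNReal.rpow_ne_top_of_nonneg hba0.le ENNReal.ofReal_ne_top)]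
      exact hN.lintegral_sum_kernelOp_rpow_rpow_le_of_le hh ha hab n
    · have hpa := Real.HolderConjugate.conjExponent (hb.trans hab)
      have hpb := Real.HolderConjugate.conjExponent hb
      refine ⟨(((ENNReal.ofReal (b.conjExponent / a.conjExponent) ^
        (b.conjExponent / a.conjExponent)) ^ (1 / b.conjExponent)) ^ b).toNNReal, ?_⟩
      intro X _ μ _ N hN h hh n
      rw [ENNReal.coe_toNNReal]
      · exact hN.lintegral_sum_kernelOp_rpow_rpow_le_of_lt hh hb hab n
      · exact ENNReal.rpow_ne_top_of_nonneg (by linarith)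
          (ENNReal.rpow_ne_top_of_nonneg hpb.symm.one_div_nonneg
            (ENNReal.rpow_ne_top_of_nonneg (div_nonneg hpb.symm.nonneg hpa.symm.nonneg)
              ENNReal.ofReal_ne_top))
  refine ⟨C, ?_⟩
  intro X _ μ _ N hN h hh
  have hmono : Monotone fun n x =>
      (∑ k ∈ Finset.range n, kernelOp μ (N k) (h k) x ^ a) ^ (b / a) := by
    intro m n hmn x
    exact ENNReal.rpow_le_rpow (Finset.sum_le_sum_of_subset (Finset.range_mono hmn)) hba0.le
  have hlim : ∀ x, (∑' k, kernelOp μ (N k) (h k) x ^ a) ^ (b / a) =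
      ⨆ n, (∑ k ∈ Finset.range n, kernelOp μ (N k) (h k) x ^ a) ^ (b / a) := by
    intro x
    rw [ENNReal.tsum_eq_iSup_nat]
    exact (ENNReal.orderIsoRpow (b / a) hba0).map_iSup _
  simp_rw [hlim]
  rw [lintegral_iSup _ hmono]
  · refine iSup_le fun n => (hC hN h hh n).trans ?_
    gcongr
    exact ENNReal.sum_le_tsum _
  · exact fun n => (Finset.measurable_sum _ fun k _ =>
      (hN.measurable_kernelOp k (hh k)).pow_const a).pow_const _

end Kernel

/-! ### Mean values of powers of holomorphic functions -/

theorem measurable_indicator_of_continuousOn {g : ℂ → ℂ} {s : Set ℂ} (hs : MeasurableSet s)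
    (hg : ContinuousOn g s) : Measurable (s.indicator g) := by
  classical
  rw [← Set.piecewise_eq_indicator]
  exact hg.measurable_piecewise continuousOn_const hs

/-- Integration in polar coordinates, with the angle ranging over `(0, 2π)`. -/
theorem lintegral_polar {φ : ℂ → ℝ≥0∞} (hφ : Measurable φ) :
    ∫⁻ w, φ w = ∫⁻ r in Set.Ioi (0 : ℝ), ENNReal.ofReal r *
      ∫⁻ θ in Set.Ioo (0 : ℝ) (2 * Real.pi), φ ((r : ℂ) * Complex.exp ((θ : ℂ) * Complex.I)) := by
  have hcont : Continuous fun p : ℝ × ℝ => -Complex.polarCoord.symm p := by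
    simp_rw [Complex.polarCoord_symm_apply]; fun_prop
  -- The reflection `w ↦ -w` moves the branch cut of the angle from `π` to `0`.
  have e1 : ∫⁻ w, φ w = ∫⁻ w, φ (-w) :=
    ((Measure.measurePreserving_neg (volume : Measure ℂ)).lintegral_comp hφ).symm
  rw [e1, ← Complex.lintegral_comp_polarCoord_symm, polarCoord_target, Measure.volume_eq_prod,
    ← Measure.prod_restrict, lintegral_prod]
  · refine lintegral_congr fun r => ?_
    simp only [smul_eq_mul]
    rw [lintegral_const_mul]
    · congr 1
      have e2 := ((measurePreserving_add_right (volume : Measure ℝ) Real.pi).setLIntegral_comp_preimage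
        (measurableSet_Ioo (a := (0 : ℝ)) (b := 2 * Real.pi))
        (f := fun θ : ℝ => φ ((r : ℂ) * Complex.exp ((θ : ℂ) * Complex.I))) (by fun_prop))
      rw [← e2]
      have e3 : (fun x => x + Real.pi) ⁻¹' Set.Ioo 0 (2 * Real.pi) = Set.Ioo (-Real.pi) Real.pi := by
        ext x; simp only [Set.mem_preimage, Set.mem_Ioo]
        constructor <;> rintro ⟨h1, h2⟩ <;> constructor <;> linarith
      rw [e3]
      refine lintegral_congr fun θ => ?_
      congr 1
      rw [Complex.polarCoord_symm_apply]
      push_cast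
      rw [add_mul, Complex.exp_add, Complex.exp_pi_mul_I, Complex.exp_mul_I]
      ring
    · exact hφ.comp (hcont.comp (Continuous.prodMk_right r)).measurable
  · refine Measurable.aemeasurable ?_
    refine (ENNReal.measurable_ofReal.comp measurable_fst).smul ?_
    exact hφ.comp hcont.measurable

/-- Mean value property on circles. -/
theorem two_pi_mul_enorm_le_lintegral_circle {g : ℂ → ℂ} {z : ℂ} {r R : ℝ} (hr : 0 < r)
    (hrR : r < R) (hg : DifferentiableOn ℂ g (Metric.ball z R)) :
    ENNReal.ofReal (2 * Real.pi) * ‖g z‖ₑ ≤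
      ∫⁻ θ in Set.Ioo (0 : ℝ) (2 * Real.pi),
        ‖g (z + (r : ℂ) * Complex.exp ((θ : ℂ) * Complex.I))‖ₑ := by
  have hd : DiffContOnCl ℂ g (Metric.ball z |r|) := by
    refine DifferentiableOn.diffContOnCl (hg.mono ?_)
    rw [abs_of_pos hr]
    exact Metric.closure_ball_subset_closedBall.trans (Metric.closedBall_subset_ball hrR)
  have h := hd.circleAverage
  rw [Real.circleAverage, intervalIntegral.integral_of_le Real.two_pi_pos.le] at h
  have h2 : (2 * Real.pi : ℝ) • g z =
      ∫ θ in Set.Ioc (0 : ℝ) (2 * Real.pi), g (circleMap z r θ) := by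
    rw [← h, smul_smul, mul_inv_cancel₀ Real.two_pi_pos.ne', one_smul]
  calc ENNReal.ofReal (2 * Real.pi) * ‖g z‖ₑ = ‖(2 * Real.pi : ℝ) • g z‖ₑ := by
        rw [enorm_smul, Real.enorm_of_nonneg Real.two_pi_pos.le]
    _ ≤ ∫⁻ θ in Set.Ioc (0 : ℝ) (2 * Real.pi), ‖g (circleMap z r θ)‖ₑ := by
        rw [h2]; exact enorm_integral_le_lintegral_enorm _
    _ = _ := by
        rw [Measure.restrict_congr_set Ioo_ae_eq_Ioc.symm]
        rfl

/-- Sub-mean-value property of `|g|` on discs; the sharp constant would be `π`. -/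
theorem ofReal_sq_mul_enorm_le_lintegral_ball {g : ℂ → ℂ} {z : ℂ} {R : ℝ} (hR : 0 < R)
    (hg : DifferentiableOn ℂ g (Metric.ball z R)) :
    ENNReal.ofReal (R ^ 2) * ‖g z‖ₑ ≤ ∫⁻ w in Metric.ball z R, ‖g w‖ₑ := by
  have hm : Measurable fun w => ‖(Metric.ball z R).indicator g (z + w)‖ₑ :=
    ((measurable_indicator_of_continuousOn measurableSet_ball hg.continuousOn).comp
      (measurable_const_add z)).enorm
  have e : ∫⁻ w in Metric.ball z R, ‖g w‖ₑ =
      ∫⁻ w, ‖(Metric.ball z R).indicator g (z + w)‖ₑ := by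
    rw [lintegral_add_left_eq_self (fun w => ‖(Metric.ball z R).indicator g w‖ₑ) z,
      ← lintegral_indicator measurableSet_ball]
    simp_rw [enorm_indicator_eq_indicator_enorm]
  rw [e, lintegral_polar hm]
  calc ENNReal.ofReal (R ^ 2) * ‖g z‖ₑ
      ≤ ENNReal.ofReal (R / 2) * (ENNReal.ofReal (2 * Real.pi) * ‖g z‖ₑ) *
          ENNReal.ofReal (R / 2) := by
        rw [← mul_assoc, mul_right_comm, ← ENNReal.ofReal_mul (by positivity),
          ← ENNReal.ofReal_mul (by positivity)]
        gcongr
        nlinarith [Real.pi_gt_three, sq_nonneg R]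
    _ = ∫⁻ r in Set.Ioo (R / 2) R,
          ENNReal.ofReal (R / 2) * (ENNReal.ofReal (2 * Real.pi) * ‖g z‖ₑ) := by
        rw [setLIntegral_const, Real.volume_Ioo]; congr 2; ring
    _ ≤ ∫⁻ r in Set.Ioo (R / 2) R, ENNReal.ofReal r *
          ∫⁻ θ in Set.Ioo (0 : ℝ) (2 * Real.pi), ‖(Metric.ball z R).indicator g
            (z + (r : ℂ) * Complex.exp ((θ : ℂ) * Complex.I))‖ₑ := by
        refine setLIntegral_mono' measurableSet_Ioo fun r hr => ?_
        have hr0 : 0 < r := by linarith [hr.1]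
        refine mul_le_mul' (ENNReal.ofReal_le_ofReal hr.1.le)
          ((two_pi_mul_enorm_le_lintegral_circle hr0 hr.2 hg).trans (le_of_eq ?_))
        refine lintegral_congr fun θ => ?_
        rw [Set.indicator_of_mem]
        rw [mem_ball_iff_norm, add_sub_cancel_left, norm_mul, Complex.norm_exp_ofReal_mul_I,
          mul_one, Complex.norm_real, Real.norm_of_nonneg hr0.le]
        exact hr.2
    _ ≤ _ := lintegral_mono_set fun r hr => lt_trans (by linarith) hr.1

theorem enorm_rpow_half (x : ℂ) : ‖x‖ₑ ^ (1 / 2 : ℝ) = ENNReal.ofReal (√‖x‖) := by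
  rw [← ofReal_norm, ENNReal.ofReal_rpow_of_nonneg (norm_nonneg _) (by norm_num),
    Real.sqrt_eq_rpow]

/-- Sub-mean-value property of `|g|^{1/2}` with a non-optimal constant. It follows from the one of
`|g|` by looking at the maximum point of `(R - |w - z|)^4 |g w|`. -/
theorem ofReal_sq_mul_enorm_rpow_half_le {g : ℂ → ℂ} {z : ℂ} {R : ℝ} (hR : 0 < R)
    (hc : ContinuousOn g (Metric.closedBall z R))
    (hg : DifferentiableOn ℂ g (Metric.ball z R)) :
    ENNReal.ofReal (R ^ 2) * ‖g z‖ₑ ^ (1 / 2 : ℝ) ≤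
      16 * ∫⁻ w in Metric.ball z R, ‖g w‖ₑ ^ (1 / 2 : ℝ) := by
  rcases eq_or_ne (g z) 0 with h0 | h0
  · simp [h0]
  set I := ∫⁻ w in Metric.ball z R, ‖g w‖ₑ ^ (1 / 2 : ℝ) with hI
  by_cases hItop : I = ⊤
  · rw [hItop, ENNReal.mul_top (by norm_num)]; exact le_top
  obtain ⟨w₀, hw₀, hmax⟩ := (isCompact_closedBall z R).exists_isMaxOn
    (f := fun w => (R - dist w z) ^ 4 * ‖g w‖) ⟨z, Metric.mem_closedBall_self hR.le⟩
    ((by fun_prop : Continuous fun w => (R - dist w z) ^ 4).continuousOn.mul hc.norm)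
  set d := R - dist w₀ z with hd
  set m := d ^ 4 * ‖g w₀‖ with hm
  have hzm : R ^ 4 * ‖g z‖ ≤ m := by
    simpa using hmax (Metric.mem_closedBall_self hR.le)
  have hm0 : 0 < m := lt_of_lt_of_le (mul_pos (by positivity) (norm_pos_iff.2 h0)) hzm
  have hd0 : 0 < d := by
    rcases (sub_nonneg.2 (Metric.mem_closedBall.1 hw₀)).eq_or_lt with h | h
    · rw [hm, hd, ← h] at hm0; norm_num at hm0
    · exact h
  have hsub : Metric.ball w₀ (d / 2) ⊆ Metric.ball z R := by
    refine Metric.ball_subset_ball' ?_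
    linarith
  have hbd : ∀ w ∈ Metric.ball w₀ (d / 2), √‖g w‖ ≤ 4 * √m / d ^ 2 := by
    intro w hw
    have h1 : (R - dist w z) ^ 4 * ‖g w‖ ≤ m := hmax (Metric.ball_subset_closedBall (hsub hw))
    have h2 : d / 2 ≤ R - dist w z := by
      have := dist_triangle w w₀ z
      have := Metric.mem_ball.1 hw
      linarith
    have h3 : (d / 2) ^ 4 * ‖g w‖ ≤ m :=
      (mul_le_mul_of_nonneg_right (pow_le_pow_left₀ (by positivity) h2 4) (norm_nonneg _)).trans h1
    refine Real.sqrt_le_iff.2 ⟨by positivity, ?_⟩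
    rw [div_pow, mul_pow, Real.sq_sqrt hm0.le, le_div_iff₀ (by positivity)]
    nlinarith
  have h1 := ofReal_sq_mul_enorm_le_lintegral_ball (half_pos hd0) (hg.mono hsub)
  have h2 : ∫⁻ w in Metric.ball w₀ (d / 2), ‖g w‖ₑ ≤ ENNReal.ofReal (4 * √m / d ^ 2) * I := by
    rw [hI, ← lintegral_const_mul' _ _ ENNReal.ofReal_ne_top]
    refine (setLIntegral_mono' measurableSet_ball fun w hw => ?_).trans (lintegral_mono_set hsub)
    rw [enorm_rpow_half, ← ENNReal.ofReal_mul (by positivity), ← ofReal_norm]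
    refine ENNReal.ofReal_le_ofReal ?_
    nth_rewrite 1 [← Real.mul_self_sqrt (norm_nonneg (g w))]
    exact mul_le_mul_of_nonneg_right (hbd w hw) (Real.sqrt_nonneg _)
  have h3 := h1.trans h2
  rw [← ENNReal.ofReal_toReal hItop] at h3 ⊢
  rw [← ofReal_norm, ← ENNReal.ofReal_mul (by positivity), ← ENNReal.ofReal_mul (by positivity),
    ENNReal.ofReal_le_ofReal_iff (by positivity)] at h3
  have h16 : (16 : ℝ≥0∞) = ENNReal.ofReal 16 := by norm_num
  rw [enorm_rpow_half, h16, ← ENNReal.ofReal_mul (by positivity),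
    ← ENNReal.ofReal_mul (by positivity)]
  refine ENNReal.ofReal_le_ofReal ?_
  have hsm : 0 < √m := Real.sqrt_pos.2 hm0
  have h4 : √m ≤ 16 * I.toReal := by
    have e1 : (d / 2) ^ 2 * ‖g w₀‖ = √m * √m / (4 * d ^ 2) := by
      rw [Real.mul_self_sqrt hm0.le, hm]; field_simp; ring
    have e2 : 4 * √m / d ^ 2 * I.toReal = √m * (16 * I.toReal) / (4 * d ^ 2) := by
      field_simp; ring
    rw [e1, e2, div_le_div_iff_of_pos_right (by positivity)] at h3
    exact le_of_mul_le_mul_left h3 hsm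
  refine le_trans ?_ h4
  refine Real.le_sqrt_of_sq_le ?_
  rw [mul_pow, Real.sq_sqrt (norm_nonneg _)]
  linarith

/-! ### Weighted holomorphic functions on the disc -/

/-- The size `|g z| (1 - |z|)^κ` of a weighted function on the disc, extended by zero. -/
noncomputable def weightedSize (κ : ℕ) (g : ℂ → ℂ) (z : ℂ) : ℝ≥0∞ :=
  ‖disc.indicator (fun z => g z * (((1 - ‖z‖) ^ κ : ℝ) : ℂ)) z‖ₑ

theorem measurable_weightedSize (κ : ℕ) {g : ℂ → ℂ} (hg : g ∈ holo) :
    Measurable (weightedSize κ g) := by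
  refine (measurable_indicator_of_continuousOn measurableSet_ball ?_).enorm
  exact (DifferentiableOn.continuousOn hg).mul
    (by fun_prop : Continuous fun z : ℂ => (((1 - ‖z‖) ^ κ : ℝ) : ℂ)).continuousOn

theorem mem_disc {z : ℂ} : z ∈ disc ↔ ‖z‖ < 1 := by simp [disc]

theorem weightedSize_of_mem (κ : ℕ) (g : ℂ → ℂ) {z : ℂ} (hz : z ∈ disc) :
    weightedSize κ g z = ‖g z‖ₑ * ENNReal.ofReal ((1 - ‖z‖) ^ κ) := by
  have h1 : 0 ≤ 1 - ‖z‖ := by linarith [mem_disc.1 hz]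
  rw [weightedSize, Set.indicator_of_mem hz, enorm_mul]
  congr 1
  rw [← ofReal_norm, Complex.norm_real, Real.norm_of_nonneg (by positivity)]

/-- On a Whitney disc the distance to the boundary is comparable to that of the centre. -/
theorem mem_closedBall_whitney {z w : ℂ} {δ : ℝ} (hδ' : δ ≤ 1 / 2) (hz : z ∈ disc)
    (hw : w ∈ Metric.closedBall z (δ * (1 - ‖z‖))) :
    (1 - ‖z‖) / 2 ≤ 1 - ‖w‖ ∧ 1 - ‖w‖ ≤ 3 / 2 * (1 - ‖z‖) := by
  have hz1 := mem_disc.1 hz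
  rw [mem_closedBall_iff_norm] at hw
  have h1 := abs_le.1 (abs_norm_sub_norm_le w z)
  have h2 : δ * (1 - ‖z‖) ≤ 1 / 2 * (1 - ‖z‖) :=
    mul_le_mul_of_nonneg_right hδ' (by linarith)
  constructor <;> linarith [h1.1, h1.2]

/-- Sub-mean-value property of `u^{1/2}` for `u = |g| (1 - |z|)^κ` on Whitney discs, with a constant
independent of `g`. -/
theorem exists_weightedSize_rpow_half_le (κ : ℕ) {δ : ℝ} (hδ : 0 < δ) (hδ' : δ ≤ 1 / 2) :
    ∃ C : NNReal, ∀ g ∈ holo, ∀ z ∈ disc,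
      ENNReal.ofReal ((1 - ‖z‖) ^ 2) * weightedSize κ g z ^ (1 / 2 : ℝ) ≤
        C * ∫⁻ w in Metric.ball z (δ * (1 - ‖z‖)), weightedSize κ g w ^ (1 / 2 : ℝ) := by
  refine ⟨(δ⁻¹ ^ 2).toNNReal * 16 * (2 ^ κ : NNReal) ^ (1 / 2 : ℝ), fun g hg z hz => ?_⟩
  have hz1 : 0 < 1 - ‖z‖ := by linarith [mem_disc.1 hz]
  set d := 1 - ‖z‖ with hd
  have hsub : Metric.closedBall z (δ * d) ⊆ disc := fun w hw =>
    mem_disc.2 (by linarith [(mem_closedBall_whitney hδ' hz hw).1])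
  have h := ofReal_sq_mul_enorm_rpow_half_le (mul_pos hδ hz1)
    ((DifferentiableOn.continuousOn hg).mono hsub)
    (DifferentiableOn.mono hg (Metric.ball_subset_closedBall.trans hsub))
  set W := ENNReal.ofReal (d ^ κ) ^ (1 / 2 : ℝ) with hW
  have h2 : (∫⁻ w in Metric.ball z (δ * d), ‖g w‖ₑ ^ (1 / 2 : ℝ)) * W ≤
      ((2 : ℝ≥0∞) ^ κ) ^ (1 / 2 : ℝ) *
        ∫⁻ w in Metric.ball z (δ * d), weightedSize κ g w ^ (1 / 2 : ℝ) := by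
    have hWt : W ≠ ⊤ := ENNReal.rpow_ne_top_of_nonneg (by norm_num) ENNReal.ofReal_ne_top
    have h2t : ((2 : ℝ≥0∞) ^ κ) ^ (1 / 2 : ℝ) ≠ ⊤ :=
      ENNReal.rpow_ne_top_of_nonneg (by norm_num) (ENNReal.pow_ne_top (by norm_num))
    rw [← lintegral_mul_const' _ _ hWt, ← lintegral_const_mul' _ _ h2t]
    refine setLIntegral_mono' measurableSet_ball fun w hw => ?_
    have hw' := Metric.ball_subset_closedBall hw
    rw [weightedSize_of_mem κ g (hsub hw'), hW,
      ← ENNReal.mul_rpow_of_nonneg _ _ (by norm_num), ← ENNReal.mul_rpow_of_nonneg _ _ (by norm_num)]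
    refine ENNReal.rpow_le_rpow ?_ (by norm_num)
    rw [mul_left_comm]
    refine mul_le_mul_right ?_ _
    have e2 : (2 : ℝ≥0∞) ^ κ = ENNReal.ofReal (2 ^ κ) := by
      rw [ENNReal.ofReal_pow (by norm_num)]; norm_num
    rw [e2, ← ENNReal.ofReal_mul (by positivity), ← mul_pow]
    refine ENNReal.ofReal_le_ofReal (pow_le_pow_left₀ hz1.le ?_ _)
    linarith [(mem_closedBall_whitney hδ' hz hw').1]
  have e : ENNReal.ofReal (d ^ 2) = ENNReal.ofReal (δ⁻¹ ^ 2) * ENNReal.ofReal ((δ * d) ^ 2) := by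
    rw [← ENNReal.ofReal_mul (by positivity)]; congr 1; field_simp
  rw [weightedSize_of_mem κ g hz, ENNReal.mul_rpow_of_nonneg _ _ (by norm_num), ← hW, e]
  push_cast
  calc _ = ENNReal.ofReal (δ⁻¹ ^ 2) *
        (ENNReal.ofReal ((δ * d) ^ 2) * ‖g z‖ₑ ^ (1 / 2 : ℝ)) * W := by ring
    _ ≤ ENNReal.ofReal (δ⁻¹ ^ 2) *
        (16 * ∫⁻ w in Metric.ball z (δ * d), ‖g w‖ₑ ^ (1 / 2 : ℝ)) * W := by gcongr
    _ = ENNReal.ofReal (δ⁻¹ ^ 2) * 16 *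
        ((∫⁻ w in Metric.ball z (δ * d), ‖g w‖ₑ ^ (1 / 2 : ℝ)) * W) := by ring
    _ ≤ ENNReal.ofReal (δ⁻¹ ^ 2) * 16 * (((2 : ℝ≥0∞) ^ κ) ^ (1 / 2 : ℝ) *
        ∫⁻ w in Metric.ball z (δ * d), weightedSize κ g w ^ (1 / 2 : ℝ)) := by gcongr
    _ = _ := by
      rw [ENNReal.coe_rpow_of_nonneg _ (by norm_num), ← mul_assoc]; push_cast; rfl

/-- The sub-mean-value property passes from the exponent `1/2` to larger exponents by Jensen. -/
theorem exists_rpow_le_of_rpow_half_le (C : NNReal) {δ p : ℝ} (hδ : 0 < δ) (hp : 1 ≤ p) :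
    ∃ C' : NNReal, ∀ u : ℂ → ℝ≥0∞, Measurable u → ∀ z ∈ disc,
      ENNReal.ofReal ((1 - ‖z‖) ^ 2) * u z ^ (1 / 2 : ℝ) ≤
        C * ∫⁻ w in Metric.ball z (δ * (1 - ‖z‖)), u w ^ (1 / 2 : ℝ) →
      ENNReal.ofReal ((1 - ‖z‖) ^ 2) * u z ^ p ≤
        C' * ∫⁻ w in Metric.ball z (δ * (1 - ‖z‖)), u w ^ p := by
  refine ⟨C ^ (2 * p) * (δ ^ 2 * Real.pi).toNNReal ^ (2 * p - 1), fun u hu z hz h => ?_⟩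
  have hz1 : 0 < 1 - ‖z‖ := by linarith [mem_disc.1 hz]
  set d := 1 - ‖z‖ with hd
  have hp0 : (0 : ℝ) ≤ 2 * p := by linarith
  have hD0 : ENNReal.ofReal (d ^ 2) ≠ 0 := (ENNReal.ofReal_pos.2 (by positivity)).ne'
  have hD1 : ENNReal.ofReal (d ^ 2) ≠ ⊤ := ENNReal.ofReal_ne_top
  have hhalf : ∀ x : ℝ≥0∞, (x ^ (1 / 2 : ℝ)) ^ (2 * p) = x ^ p := fun x => by
    rw [← ENNReal.rpow_mul]; congr 1; ring
  have h1 := ENNReal.rpow_le_rpow h hp0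
  have h2 := lintegral_rpow_le_measure_rpow_mul
    (volume.restrict (Metric.ball z (δ * d))) (a := 2 * p) (by linarith)
    (hu.pow_const (1 / 2 : ℝ)).aemeasurable
  simp_rw [hhalf] at h2
  rw [Measure.restrict_apply_univ, Complex.volume_ball] at h2
  rw [ENNReal.mul_rpow_of_nonneg _ _ hp0, ENNReal.mul_rpow_of_nonneg _ _ hp0, hhalf] at h1
  have hvol : ENNReal.ofReal (δ * d) ^ 2 * (NNReal.pi : ℝ≥0∞) =
      ENNReal.ofReal (δ ^ 2 * Real.pi) * ENNReal.ofReal (d ^ 2) := by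
    have : (NNReal.pi : ℝ≥0∞) = ENNReal.ofReal Real.pi := by
      rw [← NNReal.coe_real_pi, ENNReal.ofReal_coe_nnreal]
    rw [this, ← ENNReal.ofReal_pow (by positivity), ← ENNReal.ofReal_mul (by positivity),
      ← ENNReal.ofReal_mul (by positivity)]
    congr 1; ring
  rw [hvol, ENNReal.mul_rpow_of_nonneg _ _ (by linarith)] at h2
  have e : ENNReal.ofReal (d ^ 2) ^ (2 * p) =
      ENNReal.ofReal (d ^ 2) ^ (2 * p - 1) * ENNReal.ofReal (d ^ 2) := by
    nth_rewrite 3 [← ENNReal.rpow_one (ENNReal.ofReal (d ^ 2))]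
    rw [← ENNReal.rpow_add _ _ hD0 hD1]; congr 1; ring
  set E := ENNReal.ofReal (d ^ 2) ^ (2 * p - 1) with hE
  have hE0 : E ≠ 0 := (ENNReal.rpow_pos (pos_iff_ne_zero.2 hD0) hD1).ne'
  have hE1 : E ≠ ⊤ := ENNReal.rpow_ne_top_of_nonneg (by linarith) hD1
  rw [e] at h1
  have h3 := h1.trans (mul_le_mul_right h2 _)
  push_cast [ENNReal.coe_rpow_of_nonneg _ hp0,
    ENNReal.coe_rpow_of_nonneg _ (show 0 ≤ 2 * p - 1 by linarith)]
  refine (ENNReal.mul_le_mul_iff_right hE0 hE1).1 ?_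
  calc _ = _ := by rw [mul_assoc]
    _ ≤ _ := h3
    _ = _ := by simp only [ENNReal.ofReal]; ring

/-- By the maximum principle a central disc contributes no more than one point of its boundary
circle, up to a constant. -/
theorem exists_norm_eq_weightedSize_le (κ : ℕ) {r : ℝ} (hr : 0 < r) (hr1 : r < 1) :
    ∃ C : NNReal, ∀ g ∈ holo, ∃ w₀ : ℂ, ‖w₀‖ = r ∧
      ∀ z, ‖z‖ ≤ r → weightedSize κ g z ≤ C * weightedSize κ g w₀ := by
  refine ⟨((1 - r) ^ κ)⁻¹.toNNReal, fun g hg => ?_⟩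
  have hsub : Metric.closedBall (0 : ℂ) r ⊆ disc := Metric.closedBall_subset_ball hr1
  have hd : DiffContOnCl ℂ g (Metric.ball 0 r) := by
    refine DifferentiableOn.diffContOnCl (DifferentiableOn.mono hg ?_)
    exact Metric.closure_ball_subset_closedBall.trans hsub
  obtain ⟨w₀, hw₀, hmax⟩ := Complex.exists_mem_frontier_isMaxOn_norm Metric.isBounded_ball
    (Metric.nonempty_ball.2 hr) hd
  rw [frontier_ball _ hr.ne', mem_sphere_zero_iff_norm] at hw₀
  refine ⟨w₀, hw₀, fun z hz => ?_⟩
  have hzb : z ∈ Metric.closedBall (0 : ℂ) r := by simpa using hz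
  have hle : ‖g z‖ ≤ ‖g w₀‖ := hmax (by rwa [closure_ball _ hr.ne'])
  have hpos : 0 < 1 - r := by linarith
  rw [weightedSize_of_mem κ g (hsub hzb),
    weightedSize_of_mem κ g (mem_disc.2 (by linarith)), hw₀, mul_left_comm]
  change _ ≤ ‖g w₀‖ₑ * (ENNReal.ofReal _ * _)
  rw [← ENNReal.ofReal_mul (by positivity), inv_mul_cancel₀ (by positivity)]
  refine mul_le_mul' ?_ (ENNReal.ofReal_le_ofReal ?_)
  · rwa [← ofReal_norm, ← ofReal_norm, ENNReal.ofReal_le_ofReal_iff (norm_nonneg _)]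
  · exact pow_le_one₀ (by linarith) (by linarith [norm_nonneg z])

/-! ### Dyadic averages on the circle -/

/-- Averaging kernels can be repeated or skipped along a monotone reindexing. -/
theorem IsAveraging.comp {X : Type*} [MeasurableSpace X] {μ : Measure X}
    {N : ℕ → X → X → ℝ≥0∞} (hN : IsAveraging μ N) {e : ℕ → ℕ} (he : Monotone e) :
    IsAveraging μ fun k => N (e k) where
  measurable k := hN.measurable (e k)
  symm k := hN.symm (e k)
  lintegral_le_one k := hN.lintegral_le_one (e k)
  coherent _ _ x y hjk h := hN.coherent _ _ x y (he hjk) h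

/-- Lebesgue measure on the parameter interval `(0, 2π)` of the unit circle. -/
noncomputable def circleMeasure : Measure ℝ := volume.restrict (Set.Ioo 0 (2 * Real.pi))

instance : IsFiniteMeasure circleMeasure := by
  rw [circleMeasure]
  exact ⟨by rw [Measure.restrict_apply_univ, Real.volume_Ioo]; exact ENNReal.ofReal_lt_top⟩

/-- The index of the arc of length `2π / 2^k` containing `e^{it}`, in the dyadic grid of the circle
rotated by `s` turns. Reduction modulo `2^k` makes it `2π`-periodic in `t`. -/
noncomputable def dyadicIndex (s : ℝ) (k : ℕ) (t : ℝ) : ℤ :=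
  ⌊2 ^ k * (t / (2 * Real.pi) + s)⌋ % 2 ^ k

theorem measurable_dyadicIndex (s : ℝ) (k : ℕ) : Measurable (dyadicIndex s k) := by
  have h : Measurable fun m : ℤ => m % 2 ^ k := measurable_from_top
  exact h.comp (Int.measurable_floor.comp (by fun_prop))

theorem dyadicIndex_eq_of_le {s : ℝ} {j k : ℕ} (hjk : j ≤ k) {x y : ℝ}
    (h : dyadicIndex s k x = dyadicIndex s k y) : dyadicIndex s j x = dyadicIndex s j y := by
  obtain ⟨l, rfl⟩ := Nat.exists_eq_add_of_le hjk
  have e : ∀ a : ℝ, ⌊2 ^ j * a⌋ = ⌊2 ^ (j + l) * a⌋ / ((2 ^ l : ℕ) : ℤ) := by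
    intro a
    rw [← Int.floor_div_natCast]
    congr 1
    push_cast
    rw [pow_add]; field_simp
  obtain ⟨q, hq⟩ := (Int.ModEq.dvd (show _ ≡ _ [ZMOD 2 ^ (j + l)] from h))
  unfold dyadicIndex
  rw [e, e, eq_add_of_sub_eq hq]
  have e2 : (2 : ℤ) ^ (j + l) * q = (2 ^ j * q) * ((2 ^ l : ℕ) : ℤ) := by
    push_cast; ring
  rw [e2, add_comm (_ * _), Int.add_mul_ediv_right _ _ (by positivity)]
  simp [Int.add_mul_emod_self_left]

/-- The set of parameters in the same dyadic arc as `t`. -/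
def dyadicCell (s : ℝ) (k : ℕ) (t : ℝ) : Set ℝ := {θ | dyadicIndex s k θ = dyadicIndex s k t}

theorem measurableSet_dyadicCell (s : ℝ) (k : ℕ) (t : ℝ) : MeasurableSet (dyadicCell s k t) :=
  measurable_dyadicIndex s k (measurableSet_singleton _)

theorem dyadicCell_congr {s : ℝ} {k : ℕ} {x y : ℝ} (h : dyadicIndex s k x = dyadicIndex s k y) :
    dyadicCell s k x = dyadicCell s k y := by
  simp only [dyadicCell, h]

/-- The kernel of the averaging operator over the dyadic arcs of level `k`. On an arc that is null for
`circleMeasure` it is infinite, which affects no integral. -/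
noncomputable def dyadicKernel (s : ℝ) (k : ℕ) (x y : ℝ) : ℝ≥0∞ :=
  if dyadicIndex s k x = dyadicIndex s k y then (circleMeasure (dyadicCell s k x))⁻¹ else 0

theorem kernelOp_dyadicKernel (s : ℝ) (k : ℕ) (h : ℝ → ℝ≥0∞) (t : ℝ) :
    kernelOp circleMeasure (dyadicKernel s k) h t =
      ∫⁻ θ in dyadicCell s k t, (circleMeasure (dyadicCell s k t))⁻¹ * h θ ∂circleMeasure := by
  rw [kernelOp, ← lintegral_indicator (measurableSet_dyadicCell s k t)]
  refine lintegral_congr fun θ => ?_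
  by_cases hθ : dyadicIndex s k t = dyadicIndex s k θ
  · rw [Set.indicator_of_mem (show θ ∈ dyadicCell s k t from hθ.symm), dyadicKernel, if_pos hθ]
  · rw [Set.indicator_of_notMem (show θ ∉ dyadicCell s k t from fun h' => hθ (Eq.symm h')), dyadicKernel, if_neg hθ, zero_mul]

theorem isAveraging_dyadicKernel (s : ℝ) : IsAveraging circleMeasure (dyadicKernel s) where
  measurable k := by
    have hcell : Measurable fun x => (circleMeasure (dyadicCell s k x))⁻¹ := by
      have h : Measurable fun m : ℤ => (circleMeasure {θ | dyadicIndex s k θ = m})⁻¹ :=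
        measurable_from_top
      exact h.comp (measurable_dyadicIndex s k)
    refine Measurable.ite ?_ (hcell.comp measurable_fst) measurable_const
    exact measurableSet_eq_fun ((measurable_dyadicIndex s k).comp measurable_fst)
      ((measurable_dyadicIndex s k).comp measurable_snd)
  symm k x y := by
    by_cases h : dyadicIndex s k x = dyadicIndex s k y
    · rw [dyadicKernel, dyadicKernel, if_pos h, if_pos h.symm, dyadicCell_congr h]
    · rw [dyadicKernel, dyadicKernel, if_neg h, if_neg (Ne.symm h)]
  lintegral_le_one k x := by
    have := kernelOp_dyadicKernel s k (fun _ => 1) x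
    simp only [kernelOp, mul_one, lintegral_const, Measure.restrict_apply_univ] at this
    rw [this]
    exact ENNReal.inv_mul_le_one _
  coherent j k x y hjk h := by
    have hk : dyadicIndex s k x = dyadicIndex s k y := by
      by_contra hne
      exact h (if_neg hne)
    have hj := dyadicIndex_eq_of_le hjk hk
    ext z
    rw [dyadicKernel, dyadicKernel, hj, dyadicCell_congr hj]

theorem setLIntegral_dyadicCell (s : ℝ) (k : ℕ) (h : ℝ → ℝ≥0∞) (t : ℝ) :
    ∫⁻ θ in dyadicCell s k t, h θ ∂circleMeasure =
      circleMeasure (dyadicCell s k t) * kernelOp circleMeasure (dyadicKernel s k) h t := by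
  have hfin : circleMeasure (dyadicCell s k t) ≠ ⊤ := measure_ne_top _ _
  rcases eq_or_ne (circleMeasure (dyadicCell s k t)) 0 with h0 | h0
  · rw [h0, zero_mul, setLIntegral_measure_zero _ _ h0]
  · rw [kernelOp_dyadicKernel, lintegral_const_mul' _ _ (ENNReal.inv_ne_top.2 h0), ← mul_assoc,
      ENNReal.mul_inv_cancel h0 hfin, one_mul]

theorem circleMeasure_dyadicCell_le (s : ℝ) (k : ℕ) {t : ℝ} (ht : t ∈ Set.Ioo 0 (2 * Real.pi)) :
    circleMeasure (dyadicCell s k t) ≤ ENNReal.ofReal (12 * Real.pi * (1 / 2) ^ k) := by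
  have hpi := Real.pi_pos
  set ρ : ℝ := 2 * Real.pi * (1 / 2) ^ k with hρ
  have hρ0 : 0 < ρ := by positivity
  -- An arc may be cut in two by the endpoints of the parameter interval.
  have hsub : dyadicCell s k t ∩ Set.Ioo 0 (2 * Real.pi) ⊆
      (Metric.ball (t - 2 * Real.pi) ρ ∪ Metric.ball t ρ) ∪ Metric.ball (t + 2 * Real.pi) ρ := by
    rintro θ ⟨hθ, h1, h2⟩
    obtain ⟨q, hq⟩ := (Int.ModEq.dvd (show _ ≡ _ [ZMOD 2 ^ k] from hθ))
    have hq' : (⌊(2 : ℝ) ^ k * (t / (2 * Real.pi) + s)⌋ : ℝ) -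
        ⌊(2 : ℝ) ^ k * (θ / (2 * Real.pi) + s)⌋ = 2 ^ k * q := by exact_mod_cast hq
    have a1 := Int.floor_le ((2 : ℝ) ^ k * (t / (2 * Real.pi) + s))
    have a2 := Int.lt_floor_add_one ((2 : ℝ) ^ k * (t / (2 * Real.pi) + s))
    have b1 := Int.floor_le ((2 : ℝ) ^ k * (θ / (2 * Real.pi) + s))
    have b2 := Int.lt_floor_add_one ((2 : ℝ) ^ k * (θ / (2 * Real.pi) + s))
    have hd : |2 ^ k * ((t - θ) / (2 * Real.pi) - q)| < 1 := by
      have e : (2 : ℝ) ^ k * ((t - θ) / (2 * Real.pi) - q) =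
          2 ^ k * (t / (2 * Real.pi) + s) - 2 ^ k * (θ / (2 * Real.pi) + s) - 2 ^ k * q := by
        ring
      rw [e, abs_lt]
      constructor <;> linarith
    have h2k : (1 : ℝ) ≤ 2 ^ k := one_le_pow₀ (by norm_num)
    have hd2 : |t - θ - 2 * Real.pi * q| < ρ := by
      have e : t - θ - 2 * Real.pi * q =
          ρ * (2 ^ k * ((t - θ) / (2 * Real.pi) - q)) := by
        rw [hρ, one_div, inv_pow]; field_simp
      rw [e, abs_mul, abs_of_pos hρ0]
      nlinarith
    have hρ1 : ρ ≤ 2 * Real.pi := by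
      rw [hρ]
      exact mul_le_of_le_one_right (by positivity) (pow_le_one₀ (by norm_num) (by norm_num))
    have hd3 := abs_lt.1 hd2
    have q1 : (-2 : ℝ) < q := by
      by_contra hc
      push Not at hc
      nlinarith [ht.1, ht.2]
    have q2 : (q : ℝ) < 2 := by
      by_contra hc
      push Not at hc
      nlinarith [ht.1, ht.2]
    have q1' : -2 < q := by exact_mod_cast q1
    have q2' : q < 2 := by exact_mod_cast q2
    simp only [Set.mem_union, Metric.mem_ball, Real.dist_eq]
    rw [abs_sub_comm] at hd2
    have hcases : q = -1 ∨ q = 0 ∨ q = 1 := by omega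
    rcases hcases with rfl | rfl | rfl
    · right; convert hd2 using 2; push_cast; ring
    · left; right; convert hd2 using 2; push_cast; ring
    · left; left; convert hd2 using 2; push_cast; ring
  rw [circleMeasure, Measure.restrict_apply (measurableSet_dyadicCell s k t)]
  refine (measure_mono hsub).trans ((measure_union_le _ _).trans
    ((add_le_add (measure_union_le _ _) le_rfl).trans (le_of_eq ?_)))
  rw [Real.volume_ball, Real.volume_ball, Real.volume_ball, ← ENNReal.ofReal_add (by positivity)
    (by positivity), ← ENNReal.ofReal_add (by positivity) (by positivity), hρ]
  congr 1; ring

/-- The one-third trick: the grid and its rotation by a third of a turn have no nearby endpoints,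
so two nearby points lie in a common arc of one of them. -/
theorem dyadicIndex_eq_or_eq {k : ℕ} {x y : ℝ} {n : ℤ}
    (h : |x - y - 2 * Real.pi * n| < 2 * Real.pi / 3 * (1 / 2) ^ k) :
    dyadicIndex 0 k x = dyadicIndex 0 k y ∨ dyadicIndex (1 / 3) k x = dyadicIndex (1 / 3) k y := by
  by_contra hcon
  push Not at hcon
  have hpi := Real.pi_pos
  set X : ℝ := 2 ^ k * (x / (2 * Real.pi)) with hX
  set Y : ℝ := 2 ^ k * (y / (2 * Real.pi) + n) with hY
  have hXY : |X - Y| < 1 / 3 := by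
    have e : X - Y = 2 ^ k / (2 * Real.pi) * (x - y - 2 * Real.pi * n) := by
      rw [hX, hY]; field_simp; ring
    rw [e, abs_mul, abs_of_pos (by positivity)]
    calc _ < 2 ^ k / (2 * Real.pi) * (2 * Real.pi / 3 * (1 / 2) ^ k) := by gcongr
      _ = 1 / 3 := by rw [one_div, inv_pow]; field_simp
  -- A grid point separates two points with distinct indices.
  have key : ∀ s : ℝ, dyadicIndex s k x ≠ dyadicIndex s k y →
      ∃ m : ℤ, min X Y < m - 2 ^ k * s ∧ m - 2 ^ k * s ≤ max X Y := by
    intro s hs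
    have hne : ⌊X + 2 ^ k * s⌋ ≠ ⌊Y + 2 ^ k * s⌋ := by
      intro he
      apply hs
      unfold dyadicIndex
      have e1 : (2 : ℝ) ^ k * (x / (2 * Real.pi) + s) = X + 2 ^ k * s := by rw [hX]; ring
      have e2 : (2 : ℝ) ^ k * (y / (2 * Real.pi) + s) =
          Y + 2 ^ k * s - ((2 ^ k * n : ℤ) : ℝ) := by rw [hY]; push_cast; ring
      rw [e1, e2, Int.floor_sub_intCast, he]
      exact (Int.sub_mul_emod_self_left _ _ _).symm
    rcases lt_or_gt_of_ne hne with hlt | hlt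
    · refine ⟨⌊Y + 2 ^ k * s⌋, ?_, ?_⟩
      · have h1 := Int.lt_floor_add_one (X + 2 ^ k * s)
        have h2 : ((⌊X + 2 ^ k * s⌋ + 1 : ℤ) : ℝ) ≤ ⌊Y + 2 ^ k * s⌋ := by exact_mod_cast hlt
        push_cast at h2
        exact (min_le_left _ _).trans_lt (by linarith)
      · exact le_trans (by linarith [Int.floor_le (Y + 2 ^ k * s)]) (le_max_right _ _)
    · refine ⟨⌊X + 2 ^ k * s⌋, ?_, ?_⟩
      · have h1 := Int.lt_floor_add_one (Y + 2 ^ k * s)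
        have h2 : ((⌊Y + 2 ^ k * s⌋ + 1 : ℤ) : ℝ) ≤ ⌊X + 2 ^ k * s⌋ := by exact_mod_cast hlt
        push_cast at h2
        exact (min_le_right _ _).trans_lt (by linarith)
      · exact le_trans (by linarith [Int.floor_le (X + 2 ^ k * s)]) (le_max_left _ _)
  obtain ⟨m, hm1, hm2⟩ := key 0 hcon.1
  obtain ⟨m', hm1', hm2'⟩ := key (1 / 3) hcon.2
  have hmm : max X Y - min X Y < 1 / 3 := by rwa [max_sub_min_eq_abs']
  have h1 : |((3 * (m - m') + 2 ^ k : ℤ) : ℝ)| < 1 := by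
    push_cast
    rw [abs_lt]
    constructor <;> linarith
  have h2 : 3 * (m - m') + 2 ^ k = 0 := by
    rw [← Int.abs_lt_one_iff]; exact_mod_cast h1
  have h3 : (3 : ℤ) ∣ 2 ^ k := ⟨m' - m, by linarith⟩
  have h4 := Int.Prime.dvd_pow' Nat.prime_three h3
  norm_num at h4

theorem exists_abs_sub_le_norm_exp_sub (t θ : ℝ) :
    ∃ n : ℤ, |t - θ - 2 * Real.pi * n| ≤ Real.pi / 2 *
      ‖Complex.exp ((t : ℂ) * Complex.I) - Complex.exp ((θ : ℂ) * Complex.I)‖ := by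
  have hpi := Real.pi_pos
  set n := round ((t - θ) / (2 * Real.pi)) with hn
  refine ⟨n, ?_⟩
  set s := t - θ - 2 * Real.pi * n with hs
  have h1 : |s| ≤ Real.pi := by
    have h := abs_sub_round ((t - θ) / (2 * Real.pi))
    have e : s = 2 * Real.pi * ((t - θ) / (2 * Real.pi) - n) := by rw [hs]; field_simp
    rw [e, abs_mul, abs_of_pos (by positivity)]
    rw [← hn] at h
    nlinarith
  have h2 : ‖Complex.exp ((t : ℂ) * Complex.I) - Complex.exp ((θ : ℂ) * Complex.I)‖ =
      ‖2 * Real.sin (s / 2)‖ := by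
    rw [← Complex.norm_exp_I_mul_ofReal_sub_one]
    have e : Complex.exp ((t : ℂ) * Complex.I) - Complex.exp ((θ : ℂ) * Complex.I) =
        Complex.exp ((θ : ℂ) * Complex.I) * (Complex.exp (Complex.I * (s : ℂ)) - 1) := by
      rw [mul_sub, mul_one, ← Complex.exp_add]
      congr 1
      refine Complex.exp_eq_exp_iff_exists_int.2 ⟨n, ?_⟩
      rw [hs]; push_cast; ring
    rw [e, norm_mul, Complex.norm_exp_ofReal_mul_I, one_mul]
  have h3 := Real.mul_abs_le_abs_sin (x := s / 2) (by rw [abs_div, abs_two]; linarith)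
  rw [h2, norm_mul, Real.norm_eq_abs, Real.norm_eq_abs, abs_two]
  rw [abs_div, abs_two] at h3
  calc |s| = Real.pi / 2 * (2 * (2 / Real.pi * (|s| / 2))) := by field_simp
    _ ≤ _ := by gcongr

/-- The arc of radius `2^m 2^{-k}` about `e^{it}` is covered by two dyadic arcs of comparable
length containing `e^{it}`. -/
theorem setLIntegral_arc_le (m k : ℕ) {t : ℝ} (ht : t ∈ Set.Ioo 0 (2 * Real.pi))
    (h : ℝ → ℝ≥0∞) :
    ∫⁻ θ in {θ : ℝ | ‖Complex.exp ((θ : ℂ) * Complex.I) - Complex.exp ((t : ℂ) * Complex.I)‖ ≤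
        2 ^ m * (1 / 2) ^ k}, h θ ∂circleMeasure ≤
      ENNReal.ofReal (12 * Real.pi * 2 ^ m * (1 / 2) ^ k) *
        (kernelOp circleMeasure (dyadicKernel 0 (k - m)) h t +
          kernelOp circleMeasure (dyadicKernel (1 / 3) (k - m)) h t) := by
  have hpi := Real.pi_pos
  have hsub : {θ : ℝ | ‖Complex.exp ((θ : ℂ) * Complex.I) - Complex.exp ((t : ℂ) * Complex.I)‖ ≤
        2 ^ m * (1 / 2) ^ k} ⊆ dyadicCell 0 (k - m) t ∪ dyadicCell (1 / 3) (k - m) t := by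
    intro θ hθ
    rcases le_total k m with hkm | hkm
    · left
      rw [Nat.sub_eq_zero_of_le hkm]
      simp [dyadicCell, dyadicIndex]
    · obtain ⟨n, hn⟩ := exists_abs_sub_le_norm_exp_sub θ t
      refine dyadicIndex_eq_or_eq (n := n) (hn.trans_lt ?_)
      have e : (2 : ℝ) ^ m * (1 / 2) ^ k = (1 / 2) ^ (k - m) := by
        conv_lhs => rw [← Nat.sub_add_cancel hkm, pow_add]
        rw [mul_left_comm, ← mul_pow]; norm_num
      have hθ' : ‖Complex.exp ((θ : ℂ) * Complex.I) - Complex.exp ((t : ℂ) * Complex.I)‖ ≤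
        (1 / 2) ^ (k - m) := e ▸ hθ
      have h0 : (0 : ℝ) < (1 / 2) ^ (k - m) := by positivity
      calc _ ≤ Real.pi / 2 * (1 / 2) ^ (k - m) := by gcongr
        _ < _ := by nlinarith
  have hmeas : ∀ s, circleMeasure (dyadicCell s (k - m) t) ≤
      ENNReal.ofReal (12 * Real.pi * 2 ^ m * (1 / 2) ^ k) := by
    intro s
    refine (circleMeasure_dyadicCell_le s (k - m) ht).trans (ENNReal.ofReal_le_ofReal ?_)
    rw [mul_assoc (12 * Real.pi)]
    gcongr
    rcases le_total k m with hkm | hkm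
    · rw [Nat.sub_eq_zero_of_le hkm, pow_zero]
      calc (1 : ℝ) = 2 ^ m * (1 / 2) ^ m := by rw [← mul_pow]; norm_num
        _ ≤ 2 ^ m * (1 / 2) ^ k := mul_le_mul_of_nonneg_left
            (pow_le_pow_of_le_one (by norm_num) (by norm_num) hkm) (by positivity)
    · conv_rhs => rw [← Nat.sub_add_cancel hkm, pow_add]
      rw [mul_left_comm, ← mul_pow]; norm_num
  refine (lintegral_mono_set hsub).trans ((lintegral_union_le _ _ _).trans ?_)
  rw [setLIntegral_dyadicCell, setLIntegral_dyadicCell, mul_add]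
  gcongr <;> exact hmeas _

/-! ### Dyadic layers -/

section Layers

variable {X : Type*}

/-- The set where `d` is comparable to `2^{-k}`, for a function `d` such as the distance to the
boundary. -/
def dyadicLayer (d : X → ℝ) (k : ℕ) : Set X := {x | (1 / 2) ^ (k + 1) < d x ∧ d x ≤ (1 / 2) ^ k}

/-- The union of three consecutive dyadic layers. -/
def wideLayer (d : X → ℝ) (k : ℕ) : Set X :=
  {x | (1 / 2) ^ (k + 2) < d x ∧ d x ≤ 2 * (1 / 2) ^ k}

theorem exists_mem_dyadicLayer {d : X → ℝ} {x : X} (h0 : 0 < d x) (h1 : d x ≤ 1) :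
    ∃ k, x ∈ dyadicLayer d k :=
  exists_nat_pow_near_of_lt_one h0 h1 (by norm_num) (by norm_num)

theorem measurableSet_wideLayer [MeasurableSpace X] {d : X → ℝ} (hd : Measurable d) (k : ℕ) :
    MeasurableSet (wideLayer d k) :=
  (measurableSet_lt measurable_const hd).inter (measurableSet_le hd measurable_const)

theorem measurableSet_dyadicLayer [MeasurableSpace X] {d : X → ℝ} (hd : Measurable d) (k : ℕ) :
    MeasurableSet (dyadicLayer d k) :=
  (measurableSet_lt measurable_const hd).inter (measurableSet_le hd measurable_const)

theorem tsum_setLIntegral_wideLayer_le [MeasurableSpace X] {d : X → ℝ} (hd : Measurable d)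
    (ν : Measure X) (φ : X → ℝ≥0∞) :
    ∑' k, ∫⁻ x in wideLayer d k, φ x ∂ν ≤ 3 * ∫⁻ x, φ x ∂ν := by
  have hlayer : ∀ c : ℝ, 0 < c → ∑' k, ∫⁻ x in dyadicLayer (fun x => c * d x) k, φ x ∂ν ≤
      ∫⁻ x, φ x ∂ν := by
    intro c hc
    rw [← lintegral_iUnion (fun k => measurableSet_dyadicLayer (hd.const_mul c) k)]
    · exact setLIntegral_le_lintegral _ _
    · have aux : ∀ i j x, i < j → x ∈ dyadicLayer (fun x => c * d x) i →
          x ∉ dyadicLayer (fun x => c * d x) j := by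
        rintro i j x hij ⟨h1, _⟩ ⟨_, h2⟩
        have : (1 / 2 : ℝ) ^ j ≤ (1 / 2) ^ (i + 1) :=
          pow_le_pow_of_le_one (by norm_num) (by norm_num) hij
        linarith
      intro i j hij
      refine Set.disjoint_left.2 fun x hx hx' => ?_
      rcases lt_or_gt_of_ne hij with h | h
      · exact aux i j x h hx hx'
      · exact aux j i x h hx' hx
  have hsub : ∀ k, wideLayer d k ⊆ (dyadicLayer (fun x => 1 / 2 * d x) k ∪
      dyadicLayer (fun x => 1 * d x) k) ∪ dyadicLayer (fun x => 2 * d x) k := by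
    rintro k x ⟨h1, h2⟩
    have e1 : (1 / 2 : ℝ) ^ (k + 1) = (1 / 2) ^ k / 2 := by rw [pow_succ]; ring
    have e2 : (1 / 2 : ℝ) ^ (k + 2) = (1 / 2) ^ k / 4 := by rw [pow_add]; ring
    simp only [dyadicLayer, Set.mem_union, Set.mem_ofPred_eq, e1]
    rw [e2] at h1
    rcases lt_or_ge ((1 / 2 : ℝ) ^ k) (d x) with h3 | h3
    · left; left; constructor <;> linarith
    rcases lt_or_ge ((1 / 2 : ℝ) ^ k / 2) (d x) with h4 | h4
    · left; right; constructor <;> linarith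
    · right; constructor <;> linarith
  calc ∑' k, ∫⁻ x in wideLayer d k, φ x ∂ν
      ≤ ∑' k, ((∫⁻ x in dyadicLayer (fun x => 1 / 2 * d x) k, φ x ∂ν +
        ∫⁻ x in dyadicLayer (fun x => 1 * d x) k, φ x ∂ν) +
        ∫⁻ x in dyadicLayer (fun x => 2 * d x) k, φ x ∂ν) := by
        refine ENNReal.tsum_le_tsum fun k => (lintegral_mono_set (hsub k)).trans ?_
        exact (lintegral_union_le _ _ _).trans (add_le_add (lintegral_union_le _ _ _) le_rfl)
    _ ≤ (∫⁻ x, φ x ∂ν + ∫⁻ x, φ x ∂ν) + ∫⁻ x, φ x ∂ν := by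
        rw [ENNReal.tsum_add, ENNReal.tsum_add]
        exact add_le_add (add_le_add (hlayer _ (by norm_num)) (hlayer _ one_pos))
          (hlayer _ two_pos)
    _ = _ := by ring

end Layers

/-! ### Conical integrals are bounded by radial integrals -/

/-- The integral of `|f|^p` over a radius, in terms of `u = |f|`. -/
noncomputable def radialInt (p : ℝ) (u : ℂ → ℝ≥0∞) (t : ℝ) : ℝ≥0∞ :=
  ∫⁻ r in Set.Ioo (0 : ℝ) 1, u ((r : ℂ) * Complex.exp ((t : ℂ) * Complex.I)) ^ p

/-- The integral over a nontangential region in the norm of `T_p^q(1)`, in terms of `u = |f|`. -/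
noncomputable def conicalInt (M p : ℝ) (u : ℂ → ℝ≥0∞) (t : ℝ) : ℝ≥0∞ :=
  ∫⁻ z in nontangential M (Complex.exp ((t : ℂ) * Complex.I)),
    u z ^ p / ENNReal.ofReal (1 - ‖z‖ ^ 2)

/-- The radial integrals of `u^{1/2}` over the part of the radius at distance about `2^{-k}` from
the boundary. -/
noncomputable def layerInt (u : ℂ → ℝ≥0∞) (k : ℕ) (θ : ℝ) : ℝ≥0∞ :=
  ∫⁻ r in wideLayer (fun r : ℝ => 1 - r) k,
    u ((r : ℂ) * Complex.exp ((θ : ℂ) * Complex.I)) ^ (1 / 2 : ℝ)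
      ∂(volume.restrict (Set.Ioo (0 : ℝ) 1))

theorem measurable_layerInt {u : ℂ → ℝ≥0∞} (hu : Measurable u) (k : ℕ) :
    Measurable (layerInt u k) := by
  unfold layerInt
  refine Measurable.lintegral_prod_right' (f := fun p : ℝ × ℝ =>
    u ((p.2 : ℂ) * Complex.exp ((p.1 : ℂ) * Complex.I)) ^ (1 / 2 : ℝ)) ?_
  exact (hu.comp (by fun_prop)).pow_const _

theorem norm_ofReal_mul_exp {r : ℝ} (hr : 0 ≤ r) (θ : ℝ) :
    ‖(r : ℂ) * Complex.exp ((θ : ℂ) * Complex.I)‖ = r := by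
  rw [norm_mul, Complex.norm_exp_ofReal_mul_I, mul_one, Complex.norm_real, Real.norm_of_nonneg hr]

/-- A Whitney disc seen from `e^{it}` is contained in a polar rectangle of comparable size. -/
theorem setLIntegral_whitney_ball_le {M : ℝ} {m : ℕ} (hM : 0 < M) (hm : 2 * M + 5 / 2 ≤ 2 ^ m)
    {u : ℂ → ℝ≥0∞} (hu : Measurable u) {k : ℕ} {t : ℝ} {z : ℂ}
    (hz : z ∈ nontangential M (Complex.exp ((t : ℂ) * Complex.I)))
    (hzk : z ∈ dyadicLayer (fun z : ℂ => 1 - ‖z‖) k) :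
    ∫⁻ w in Metric.ball z (1 / 2 * (1 - ‖z‖)), u w ^ (1 / 2 : ℝ) ≤
      ∫⁻ θ in {θ : ℝ | ‖Complex.exp ((θ : ℂ) * Complex.I) - Complex.exp ((t : ℂ) * Complex.I)‖ ≤
        2 ^ m * (1 / 2) ^ k}, layerInt u k θ ∂circleMeasure := by
  obtain ⟨hzd, hzM⟩ := hz
  have hz1 := mem_disc.1 hzd
  obtain ⟨hk1, hk2⟩ := hzk
  set S := Metric.ball z (1 / 2 * (1 - ‖z‖)) with hS
  set A : Set ℝ := {θ : ℝ | ‖Complex.exp ((θ : ℂ) * Complex.I) -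
    Complex.exp ((t : ℂ) * Complex.I)‖ ≤ 2 ^ m * (1 / 2) ^ k} with hA
  have hAm : MeasurableSet A := measurableSet_le (by fun_prop) measurable_const
  set L := wideLayer (fun r : ℝ => 1 - r) k with hL
  have hLm : MeasurableSet L := measurableSet_wideLayer (by fun_prop) k
  have hrect : ∀ r : ℝ, 0 < r → ∀ θ : ℝ, (r : ℂ) * Complex.exp ((θ : ℂ) * Complex.I) ∈ S →
      r < 1 ∧ r ∈ L ∧ θ ∈ A := by
    intro r hr θ hw
    have h1 := mem_closedBall_whitney le_rfl hzd (Metric.ball_subset_closedBall hw)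
    rw [norm_ofReal_mul_exp hr.le] at h1
    have e1 : (1 / 2 : ℝ) ^ (k + 1) = (1 / 2) ^ k / 2 := by rw [pow_succ]; ring
    have e2 : (1 / 2 : ℝ) ^ (k + 2) = (1 / 2) ^ k / 4 := by rw [pow_add]; ring
    have e0 : (0 : ℝ) < (1 / 2) ^ k := by positivity
    rw [e1] at hk1
    refine ⟨by linarith [h1.1], ⟨by rw [e2]; linarith [h1.1], by linarith [h1.2]⟩, ?_⟩
    have hr1 : ‖Complex.exp ((θ : ℂ) * Complex.I) -
        (r : ℂ) * Complex.exp ((θ : ℂ) * Complex.I)‖ = 1 - r := by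
      have : Complex.exp ((θ : ℂ) * Complex.I) - (r : ℂ) * Complex.exp ((θ : ℂ) * Complex.I) =
          ((1 - r : ℝ) : ℂ) * Complex.exp ((θ : ℂ) * Complex.I) := by push_cast; ring
      rw [this, norm_ofReal_mul_exp (by linarith [h1.1])]
    have hw' := mem_ball_iff_norm.1 hw
    have hM2 : M * (1 - ‖z‖ ^ 2) ≤ M * (2 * (1 / 2) ^ k) := by
      refine mul_le_mul_of_nonneg_left ?_ hM.le
      nlinarith [norm_nonneg z]
    calc ‖Complex.exp ((θ : ℂ) * Complex.I) - Complex.exp ((t : ℂ) * Complex.I)‖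
        ≤ ‖Complex.exp ((θ : ℂ) * Complex.I) - (r : ℂ) * Complex.exp ((θ : ℂ) * Complex.I)‖ +
          ‖(r : ℂ) * Complex.exp ((θ : ℂ) * Complex.I) - z‖ +
          ‖z - Complex.exp ((t : ℂ) * Complex.I)‖ := by
          refine (norm_sub_le_norm_sub_add_norm_sub _ z _).trans ?_
          gcongr
          exact norm_sub_le_norm_sub_add_norm_sub _ _ _
      _ ≤ (2 * M + 5 / 2) * (1 / 2) ^ k := by rw [hr1]; linarith [h1.2]
      _ ≤ _ := by gcongr
  rw [← lintegral_indicator measurableSet_ball, lintegral_polar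
    ((hu.pow_const _).indicator measurableSet_ball)]
  calc ∫⁻ r in Set.Ioi (0 : ℝ), ENNReal.ofReal r * ∫⁻ θ in Set.Ioo (0 : ℝ) (2 * Real.pi),
        S.indicator (fun w => u w ^ (1 / 2 : ℝ)) ((r : ℂ) * Complex.exp ((θ : ℂ) * Complex.I))
      ≤ ∫⁻ r in Set.Ioi (0 : ℝ), (Set.Ioo (0 : ℝ) 1 ∩ L).indicator (fun r =>
          ∫⁻ θ in A, u ((r : ℂ) * Complex.exp ((θ : ℂ) * Complex.I)) ^ (1 / 2 : ℝ)
            ∂circleMeasure) r := by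
        refine setLIntegral_mono' measurableSet_Ioi fun r hr => ?_
        have hr0 : 0 < r := hr
        by_cases hrL : r ∈ Set.Ioo (0 : ℝ) 1 ∩ L
        · rw [Set.indicator_of_mem hrL]
          refine mul_le_of_le_one_of_le (ENNReal.ofReal_le_one.2 hrL.1.2.le) ?_
          rw [← lintegral_indicator hAm]
          refine lintegral_mono fun θ => ?_
          by_cases hw : (r : ℂ) * Complex.exp ((θ : ℂ) * Complex.I) ∈ S
          · rw [Set.indicator_of_mem hw, Set.indicator_of_mem (hrect r hr0 θ hw).2.2]
          · rw [Set.indicator_of_notMem hw]; exact zero_le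
        · rw [Set.indicator_of_notMem hrL]
          refine le_of_eq ?_
          have : ∀ θ : ℝ, S.indicator (fun w => u w ^ (1 / 2 : ℝ))
              ((r : ℂ) * Complex.exp ((θ : ℂ) * Complex.I)) = 0 := fun θ =>
            Set.indicator_of_notMem (fun hw =>
              hrL ⟨⟨hr0, (hrect r hr0 θ hw).1⟩, (hrect r hr0 θ hw).2.1⟩) _
          simp_rw [this, lintegral_zero, mul_zero]
    _ ≤ ∫⁻ r in Set.Ioo (0 : ℝ) 1 ∩ L, ∫⁻ θ in A,
          u ((r : ℂ) * Complex.exp ((θ : ℂ) * Complex.I)) ^ (1 / 2 : ℝ) ∂circleMeasure := by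
        rw [← lintegral_indicator (measurableSet_Ioo.inter hLm)]
        exact setLIntegral_le_lintegral _ _
    _ = _ := by
        unfold layerInt
        rw [Measure.restrict_restrict hLm, Set.inter_comm, lintegral_lintegral_swap]
        exact ((hu.comp (by fun_prop : Measurable fun p : ℝ × ℝ =>
          (p.1 : ℂ) * Complex.exp ((p.2 : ℂ) * Complex.I))).pow_const _).aemeasurable

/-- In the `k`-th layer of a nontangential region `u^{1/2}` is dominated by dyadic averages at its
vertex. The level `k - m` is truncated at `0`, where the only arc is the whole circle. -/
theorem rpow_half_le_kernelOp {M : ℝ} {m : ℕ} (hM : 0 < M) (hm : 2 * M + 5 / 2 ≤ 2 ^ m)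
    {C : NNReal} {u : ℂ → ℝ≥0∞} (hu : Measurable u)
    (hmv : ∀ z ∈ disc, ENNReal.ofReal ((1 - ‖z‖) ^ 2) * u z ^ (1 / 2 : ℝ) ≤
      C * ∫⁻ w in Metric.ball z (1 / 2 * (1 - ‖z‖)), u w ^ (1 / 2 : ℝ))
    {k : ℕ} {t : ℝ} (ht : t ∈ Set.Ioo 0 (2 * Real.pi)) {z : ℂ}
    (hz : z ∈ nontangential M (Complex.exp ((t : ℂ) * Complex.I)))
    (hzk : z ∈ dyadicLayer (fun z : ℂ => 1 - ‖z‖) k) :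
    u z ^ (1 / 2 : ℝ) ≤ C * ENNReal.ofReal (48 * Real.pi * 2 ^ m) * (ENNReal.ofReal (2 ^ k) *
      (kernelOp circleMeasure (dyadicKernel 0 (k - m)) (layerInt u k) t +
        kernelOp circleMeasure (dyadicKernel (1 / 3) (k - m)) (layerInt u k) t)) := by
  have hpi := Real.pi_pos
  have h := (hmv z hz.1).trans (mul_le_mul_right
    ((setLIntegral_whitney_ball_le hM hm hu hz hzk).trans (setLIntegral_arc_le m k ht _)) _)
  set E := kernelOp circleMeasure (dyadicKernel 0 (k - m)) (layerInt u k) t +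
        kernelOp circleMeasure (dyadicKernel (1 / 3) (k - m)) (layerInt u k) t with hE
  have e1 : (1 / 2 : ℝ) ^ (k + 1) = (1 / 2) ^ k / 2 := by rw [pow_succ]; ring
  have hd : 1 ≤ ENNReal.ofReal (4 * (2 ^ k) ^ 2) * ENNReal.ofReal ((1 - ‖z‖) ^ 2) := by
    rw [← ENNReal.ofReal_mul (by positivity), ENNReal.one_le_ofReal]
    have h1 := hzk.1
    rw [e1] at h1
    have h2 : (1 : ℝ) = 2 ^ k * (1 / 2) ^ k := by rw [← mul_pow]; norm_num
    have h3 : (1 : ℝ) ≤ 2 * 2 ^ k * (1 - ‖z‖) := by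
      have : (0 : ℝ) < 2 ^ k := by positivity
      nlinarith
    nlinarith
  calc u z ^ (1 / 2 : ℝ) ≤ ENNReal.ofReal (4 * (2 ^ k) ^ 2) *
        (ENNReal.ofReal ((1 - ‖z‖) ^ 2) * u z ^ (1 / 2 : ℝ)) := by
        rw [← mul_assoc]; exact le_mul_of_one_le_left' hd
    _ ≤ ENNReal.ofReal (4 * (2 ^ k) ^ 2) *
        (C * (ENNReal.ofReal (12 * Real.pi * 2 ^ m * (1 / 2) ^ k) * E)) := by gcongr
    _ = C * (ENNReal.ofReal (4 * (2 ^ k) ^ 2) *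
          ENNReal.ofReal (12 * Real.pi * 2 ^ m * (1 / 2) ^ k)) * E := by ring
    _ = C * (ENNReal.ofReal (48 * Real.pi * 2 ^ m) * ENNReal.ofReal (2 ^ k)) * E := by
        congr 2
        rw [← ENNReal.ofReal_mul (by positivity), ← ENNReal.ofReal_mul (by positivity)]
        congr 1
        rw [one_div, inv_pow]; field_simp; norm_num
    _ = _ := by ring

theorem volume_nontangential_inter_dyadicLayer_le {M : ℝ} (hM : 0 < M) (ξ : ℂ) (k : ℕ) :
    volume (nontangential M ξ ∩ dyadicLayer (fun z : ℂ => 1 - ‖z‖) k) ≤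
      ENNReal.ofReal (4 * M ^ 2 * Real.pi * ((1 / 2) ^ k) ^ 2) := by
  have hsub : nontangential M ξ ∩ dyadicLayer (fun z : ℂ => 1 - ‖z‖) k ⊆
      Metric.ball ξ (2 * M * (1 / 2) ^ k) := by
    rintro z ⟨⟨hz, hzM⟩, _, hk⟩
    have hz1 := mem_disc.1 hz
    rw [mem_ball_iff_norm]
    refine hzM.trans_le ?_
    rw [mul_comm 2 M, mul_assoc]
    refine mul_le_mul_of_nonneg_left ?_ hM.le
    nlinarith [norm_nonneg z]
  refine (measure_mono hsub).trans (le_of_eq ?_)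
  have hpi : (NNReal.pi : ℝ≥0∞) = ENNReal.ofReal Real.pi := by
    rw [← NNReal.coe_real_pi, ENNReal.ofReal_coe_nnreal]
  rw [Complex.volume_ball, hpi, ← ENNReal.ofReal_pow (by positivity),
    ← ENNReal.ofReal_mul (by positivity)]
  congr 1; ring

/-- The normalization which turns the `k`-th radial integral into a term of an `ℓ^{2p}` norm. -/
noncomputable def layerSeq (p : ℝ) (u : ℂ → ℝ≥0∞) (k : ℕ) (θ : ℝ) : ℝ≥0∞ :=
  ENNReal.ofReal (2 ^ k) ^ ((2 * p - 1) / (2 * p)) * layerInt u k θ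

/-- The radial integral dominates the `ℓ^{2p}` norm of the normalized layer integrals, by Jensen's
inequality on each layer. -/
theorem tsum_layerSeq_rpow_le {p : ℝ} (hp : 1 ≤ p) {u : ℂ → ℝ≥0∞} (hu : Measurable u) (t : ℝ) :
    ∑' k, layerSeq p u k t ^ (2 * p) ≤ ENNReal.ofReal 2 ^ (2 * p - 1) * 3 * radialInt p u t := by
  have hp0 : 0 < 2 * p := by linarith
  have hp1 : 0 ≤ 2 * p - 1 := by linarith
  have hk : ∀ k, layerSeq p u k t ^ (2 * p) ≤ ENNReal.ofReal 2 ^ (2 * p - 1) *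
      ∫⁻ r in wideLayer (fun r : ℝ => 1 - r) k,
        u ((r : ℂ) * Complex.exp ((t : ℂ) * Complex.I)) ^ p
          ∂(volume.restrict (Set.Ioo (0 : ℝ) 1)) := by
    intro k
    set ν := (volume.restrict (Set.Ioo (0 : ℝ) 1)).restrict (wideLayer (fun r : ℝ => 1 - r) k)
      with hν
    have hvol : ν Set.univ ≤ ENNReal.ofReal (2 * (1 / 2) ^ k) := by
      have hsub : wideLayer (fun r : ℝ => 1 - r) k ∩ Set.Ioo 0 1 ⊆
          Set.Icc (1 - 2 * (1 / 2) ^ k) 1 := by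
        rintro r ⟨⟨_, h2⟩, _, h3⟩
        exact ⟨by linarith, h3.le⟩
      rw [hν, Measure.restrict_apply_univ, Measure.restrict_apply
        (measurableSet_wideLayer (by fun_prop) k)]
      refine (measure_mono hsub).trans (le_of_eq ?_)
      rw [Real.volume_Icc]
      congr 1; ring
    have hJ := lintegral_rpow_le_measure_rpow_mul ν (a := 2 * p) (by linarith)
      (φ := fun r => u ((r : ℂ) * Complex.exp ((t : ℂ) * Complex.I)) ^ (1 / 2 : ℝ))
      ((hu.comp (by fun_prop)).pow_const _).aemeasurable
    have hhalf : ∀ x : ℝ≥0∞, (x ^ (1 / 2 : ℝ)) ^ (2 * p) = x ^ p := fun x => by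
      rw [← ENNReal.rpow_mul]; congr 1; ring
    simp_rw [hhalf] at hJ
    rw [layerSeq, ENNReal.mul_rpow_of_nonneg _ _ hp0.le, ← ENNReal.rpow_mul,
      div_mul_cancel₀ _ hp0.ne']
    calc _ ≤ ENNReal.ofReal (2 ^ k) ^ (2 * p - 1) *
          (ENNReal.ofReal (2 * (1 / 2) ^ k) ^ (2 * p - 1) *
            ∫⁻ r, u ((r : ℂ) * Complex.exp ((t : ℂ) * Complex.I)) ^ p ∂ν) := by
          refine mul_le_mul_right (hJ.trans (mul_le_mul_left ?_ _)) _
          exact ENNReal.rpow_le_rpow hvol hp1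
      _ = _ := by
          rw [← mul_assoc, ← ENNReal.mul_rpow_of_nonneg _ _ hp1,
            ← ENNReal.ofReal_mul (by positivity)]
          congr 3
          rw [mul_left_comm, ← mul_pow]; norm_num
  refine (ENNReal.tsum_le_tsum hk).trans ?_
  rw [ENNReal.tsum_mul_left, mul_assoc]
  exact mul_le_mul_right (tsum_setLIntegral_wideLayer_le (by fun_prop) _ _) _

theorem kernelOp_const_mul {X : Type*} [MeasurableSpace X] {μ : Measure X} {N : X → X → ℝ≥0∞}
    {c : ℝ≥0∞} (hc : c ≠ ⊤) (h : X → ℝ≥0∞) (x : X) :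
    kernelOp μ N (fun y => c * h y) x = c * kernelOp μ N h x := by
  unfold kernelOp
  rw [← lintegral_const_mul' _ _ hc]
  exact lintegral_congr fun y => by ring

/-- Pointwise domination of the conical integral by dyadic averages of radial integrals. -/
theorem exists_conicalInt_le {M p : ℝ} (hM : 0 < M) (hp : 1 ≤ p) (C : NNReal) {m : ℕ}
    (hm : 2 * M + 5 / 2 ≤ 2 ^ m) :
    ∃ C' : ℝ≥0∞, C' ≠ ⊤ ∧ ∀ u : ℂ → ℝ≥0∞, Measurable u →
      (∀ z ∈ disc, ENNReal.ofReal ((1 - ‖z‖) ^ 2) * u z ^ (1 / 2 : ℝ) ≤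
        C * ∫⁻ w in Metric.ball z (1 / 2 * (1 - ‖z‖)), u w ^ (1 / 2 : ℝ)) →
      ∀ t ∈ Set.Ioo 0 (2 * Real.pi), conicalInt M p u t ≤ C' *
        (∑' k, kernelOp circleMeasure (dyadicKernel 0 (k - m)) (layerSeq p u k) t ^ (2 * p) +
          ∑' k, kernelOp circleMeasure (dyadicKernel (1 / 3) (k - m)) (layerSeq p u k) t ^
            (2 * p)) := by
  have hpi := Real.pi_pos
  have hp0 : 0 < 2 * p := by linarith
  have hp1 : 0 ≤ 2 * p - 1 := by linarith
  set B : ℝ≥0∞ := C * ENNReal.ofReal (48 * Real.pi * 2 ^ m) with hB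
  have hBt : B ≠ ⊤ := ENNReal.mul_ne_top ENNReal.coe_ne_top ENNReal.ofReal_ne_top
  refine ⟨B ^ (2 * p) * ENNReal.ofReal (8 * M ^ 2 * Real.pi) * 2 ^ (2 * p),
    ENNReal.mul_ne_top (ENNReal.mul_ne_top (ENNReal.rpow_ne_top_of_nonneg hp0.le hBt)
      ENNReal.ofReal_ne_top) (ENNReal.rpow_ne_top_of_nonneg hp0.le (by norm_num)),
    fun u hu hmv t ht => ?_⟩
  set Γ := nontangential M (Complex.exp ((t : ℂ) * Complex.I)) with hΓ
  set L := fun k => dyadicLayer (fun z : ℂ => 1 - ‖z‖) k with hL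
  set E0 := fun k => kernelOp circleMeasure (dyadicKernel 0 (k - m)) (layerInt u k) t with hE0
  set E1 := fun k => kernelOp circleMeasure (dyadicKernel (1 / 3) (k - m)) (layerInt u k) t
    with hE1
  have hcover : Γ ⊆ ⋃ k, Γ ∩ L k := by
    intro z hz
    have hz1 := mem_disc.1 hz.1
    obtain ⟨k, hk⟩ := exists_mem_dyadicLayer (d := fun z : ℂ => 1 - ‖z‖) (x := z)
      (by linarith) (by linarith [norm_nonneg z])
    exact Set.mem_iUnion.2 ⟨k, hz, hk⟩
  have hΓm : MeasurableSet Γ :=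
    by
    refine measurableSet_ball.inter ?_
    exact measurableSet_lt
      (by fun_prop : Measurable fun z : ℂ => ‖z - Complex.exp ((t : ℂ) * Complex.I)‖)
      (by fun_prop : Measurable fun z : ℂ => M * (1 - ‖z‖ ^ 2))
  have hkernel : ∀ s k, kernelOp circleMeasure (dyadicKernel s (k - m)) (layerSeq p u k) t ^
      (2 * p) = ENNReal.ofReal (2 ^ k) ^ (2 * p - 1) *
        kernelOp circleMeasure (dyadicKernel s (k - m)) (layerInt u k) t ^ (2 * p) := by
    intro s k
    have hfin : ENNReal.ofReal (2 ^ k) ^ ((2 * p - 1) / (2 * p)) ≠ ⊤ :=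
      ENNReal.rpow_ne_top_of_nonneg (div_nonneg hp1 hp0.le) ENNReal.ofReal_ne_top
    unfold layerSeq
    rw [kernelOp_const_mul hfin, ENNReal.mul_rpow_of_nonneg _ _ hp0.le, ← ENNReal.rpow_mul,
      div_mul_cancel₀ _ hp0.ne']
  have hterm : ∀ k, ∫⁻ z in Γ ∩ L k, u z ^ p / ENNReal.ofReal (1 - ‖z‖ ^ 2) ≤
      B ^ (2 * p) * ENNReal.ofReal (8 * M ^ 2 * Real.pi) * 2 ^ (2 * p) *
        (ENNReal.ofReal (2 ^ k) ^ (2 * p - 1) * E0 k ^ (2 * p) +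
          ENNReal.ofReal (2 ^ k) ^ (2 * p - 1) * E1 k ^ (2 * p)) := by
    intro k
    set a := ENNReal.ofReal (2 ^ k) with ha
    have ha0 : a ≠ 0 := (ENNReal.ofReal_pos.2 (by positivity)).ne'
    have hpt : ∀ z ∈ Γ ∩ L k, u z ^ p / ENNReal.ofReal (1 - ‖z‖ ^ 2) ≤
        (B * (a * (E0 k + E1 k))) ^ (2 * p) * ENNReal.ofReal (2 * 2 ^ k) := by
      rintro z ⟨hz, hzk⟩
      have hz1 := mem_disc.1 hz.1
      rw [ENNReal.div_eq_inv_mul, mul_comm]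
      refine mul_le_mul' ?_ ?_
      · have h := ENNReal.rpow_le_rpow (rpow_half_le_kernelOp hM hm hu hmv ht hz hzk) hp0.le
        rw [← ENNReal.rpow_mul, show 1 / 2 * (2 * p) = p by ring] at h
        exact h
      · rw [← ENNReal.ofReal_inv_of_pos (by nlinarith [norm_nonneg z])]
        refine ENNReal.ofReal_le_ofReal ?_
        have h1 := hzk.1
        have e : (2 : ℝ) * 2 ^ k = ((1 / 2) ^ (k + 1))⁻¹ := by
          rw [one_div, inv_pow, inv_inv, pow_succ]; ring
        rw [e]
        refine inv_anti₀ (by positivity) (h1.le.trans ?_)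
        nlinarith [norm_nonneg z]
    calc ∫⁻ z in Γ ∩ L k, u z ^ p / ENNReal.ofReal (1 - ‖z‖ ^ 2)
        ≤ ∫⁻ z in Γ ∩ L k,
            (B * (a * (E0 k + E1 k))) ^ (2 * p) * ENNReal.ofReal (2 * 2 ^ k) :=
          setLIntegral_mono' (hΓm.inter (measurableSet_dyadicLayer (by fun_prop) k)) hpt
      _ ≤ (B * (a * (E0 k + E1 k))) ^ (2 * p) * ENNReal.ofReal (2 * 2 ^ k) *
            ENNReal.ofReal (4 * M ^ 2 * Real.pi * ((1 / 2) ^ k) ^ 2) := by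
          rw [setLIntegral_const]
          exact mul_le_mul_right (volume_nontangential_inter_dyadicLayer_le hM _ k) _
      _ = B ^ (2 * p) * ENNReal.ofReal (8 * M ^ 2 * Real.pi) *
            (a ^ (2 * p - 1) * (E0 k + E1 k) ^ (2 * p)) := by
          rw [ENNReal.mul_rpow_of_nonneg B _ hp0.le, ENNReal.mul_rpow_of_nonneg a _ hp0.le]
          have e1 : a ^ (2 * p) = a ^ (2 * p - 1) * a := by
            nth_rewrite 3 [← ENNReal.rpow_one a]
            rw [← ENNReal.rpow_add _ _ ha0 ENNReal.ofReal_ne_top, sub_add_cancel]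
          have e2 : a * (ENNReal.ofReal (2 * 2 ^ k) *
              ENNReal.ofReal (4 * M ^ 2 * Real.pi * ((1 / 2) ^ k) ^ 2)) =
              ENNReal.ofReal (8 * M ^ 2 * Real.pi) := by
            rw [ha, ← ENNReal.ofReal_mul (by positivity), ← ENNReal.ofReal_mul (by positivity)]
            congr 1
            rw [one_div, inv_pow]; field_simp; norm_num
          rw [e1, ← e2]; ring
      _ ≤ B ^ (2 * p) * ENNReal.ofReal (8 * M ^ 2 * Real.pi) *
            (a ^ (2 * p - 1) * (2 ^ (2 * p) * (E0 k ^ (2 * p) + E1 k ^ (2 * p)))) := by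
          gcongr
          exact add_rpow_le_two_rpow_mul _ _ hp0.le
      _ = _ := by ring
  calc conicalInt M p u t
      ≤ ∑' k, ∫⁻ z in Γ ∩ L k, u z ^ p / ENNReal.ofReal (1 - ‖z‖ ^ 2) :=
        (lintegral_mono_set hcover).trans (lintegral_iUnion_le _ _)
    _ ≤ _ := ENNReal.tsum_le_tsum hterm
    _ = _ := by
        rw [ENNReal.tsum_mul_left, ENNReal.tsum_add]
        simp_rw [hkernel, hE0, hE1]

/-- The conical integrals are controlled by the radial ones. -/
theorem exists_lintegral_conicalInt_le {M p q : ℝ} (hM : 0 < M) (hp : 1 ≤ p) (hq : 1 ≤ q)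
    (C : NNReal) :
    ∃ C' : ℝ≥0∞, C' ≠ ⊤ ∧ ∀ u : ℂ → ℝ≥0∞, Measurable u →
      (∀ z ∈ disc, ENNReal.ofReal ((1 - ‖z‖) ^ 2) * u z ^ (1 / 2 : ℝ) ≤
        C * ∫⁻ w in Metric.ball z (1 / 2 * (1 - ‖z‖)), u w ^ (1 / 2 : ℝ)) →
      ∫⁻ t, conicalInt M p u t ^ (q / p) ∂circleMeasure ≤
        C' * ∫⁻ t, radialInt p u t ^ (q / p) ∂circleMeasure := by
  obtain ⟨m, hm⟩ := pow_unbounded_of_one_lt (2 * M + 5 / 2) (one_lt_two (α := ℝ))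
  obtain ⟨A, hA, hcon⟩ := exists_conicalInt_le hM hp C hm.le
  obtain ⟨D, hD⟩ := exists_lintegral_tsum_kernelOp_rpow_rpow_le
    (a := 2 * p) (b := 2 * q) (by linarith) (by linarith)
  have hs : 0 ≤ q / p := by positivity
  have hqp : 2 * q / (2 * p) = q / p := by field_simp
  rw [hqp] at hD
  set K : ℝ≥0∞ := ENNReal.ofReal 2 ^ (2 * p - 1) * 3 with hK
  have hKt : K ≠ ⊤ := ENNReal.mul_ne_top
    (ENNReal.rpow_ne_top_of_nonneg (by linarith) ENNReal.ofReal_ne_top) (by norm_num)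
  refine ⟨A ^ (q / p) * 2 ^ (q / p) * (2 * (D * K ^ (q / p))), ?_, fun u hu hmv => ?_⟩
  · refine ENNReal.mul_ne_top (ENNReal.mul_ne_top ?_ ?_)
      (ENNReal.mul_ne_top (by norm_num) (ENNReal.mul_ne_top ENNReal.coe_ne_top ?_))
    · exact ENNReal.rpow_ne_top_of_nonneg hs hA
    · exact ENNReal.rpow_ne_top_of_nonneg hs (by norm_num)
    · exact ENNReal.rpow_ne_top_of_nonneg hs hKt
  have hseq : ∀ k, Measurable (layerSeq p u k) := fun k =>
    (measurable_layerInt hu k).const_mul _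
  set V := fun (s : ℝ) (t : ℝ) =>
    ∑' k, kernelOp circleMeasure (dyadicKernel s (k - m)) (layerSeq p u k) t ^ (2 * p) with hV
  have hav : ∀ s, IsAveraging circleMeasure fun k => dyadicKernel s (k - m) := fun s =>
    (isAveraging_dyadicKernel s).comp fun i j hij => Nat.sub_le_sub_right hij m
  have hVm : ∀ s, Measurable (V s) := fun s =>
    Measurable.tsum fun k => ((hav s).measurable_kernelOp k (hseq k)).pow_const _
  have hVle : ∀ s, ∫⁻ t, V s t ^ (q / p) ∂circleMeasure ≤
      D * K ^ (q / p) * ∫⁻ t, radialInt p u t ^ (q / p) ∂circleMeasure := by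
    intro s
    refine (hD (hav s) _ hseq).trans ?_
    rw [mul_assoc, ← lintegral_const_mul' _ _ (ENNReal.rpow_ne_top_of_nonneg hs hKt)]
    refine mul_le_mul_right (lintegral_mono fun t => ?_) _
    rw [← ENNReal.mul_rpow_of_nonneg _ _ hs]
    exact ENNReal.rpow_le_rpow (tsum_layerSeq_rpow_le hp hu t) hs
  calc ∫⁻ t, conicalInt M p u t ^ (q / p) ∂circleMeasure
      ≤ ∫⁻ t, A ^ (q / p) * 2 ^ (q / p) * (V 0 t ^ (q / p) + V (1 / 3) t ^ (q / p))
          ∂circleMeasure := by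
        refine setLIntegral_mono' measurableSet_Ioo fun t ht => ?_
        refine (ENNReal.rpow_le_rpow (hcon u hu hmv t ht) hs).trans ?_
        rw [ENNReal.mul_rpow_of_nonneg _ _ hs, mul_assoc]
        exact mul_le_mul_right (add_rpow_le_two_rpow_mul _ _ hs) _
    _ = A ^ (q / p) * 2 ^ (q / p) * (∫⁻ t, V 0 t ^ (q / p) ∂circleMeasure +
          ∫⁻ t, V (1 / 3) t ^ (q / p) ∂circleMeasure) := by
        rw [lintegral_const_mul, lintegral_add_left]
        · exact (hVm 0).pow_const _
        · exact ((hVm 0).pow_const _).add ((hVm (1 / 3)).pow_const _)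
    _ ≤ A ^ (q / p) * 2 ^ (q / p) *
          (D * K ^ (q / p) * ∫⁻ t, radialInt p u t ^ (q / p) ∂circleMeasure +
            D * K ^ (q / p) * ∫⁻ t, radialInt p u t ^ (q / p) ∂circleMeasure) := by
        gcongr <;> exact hVle _
    _ = _ := by ring

/-! ### Radial integrals are bounded by conical integrals -/

/-- Small discs centred on a radius close to the boundary lie in the nontangential regions with
nearby vertices; this is where `M > 1/2` is needed. The constant `δ = (2 M - 1) / (8 M + 4)` is chosen
so that `1 + 2 δ ≤ 2 M (1 - δ)^2`. -/
theorem ball_subset_nontangential {M : ℝ} (hM : 1 / 2 < M) {ξ ξ' : ℂ} (hξ : ‖ξ‖ = 1)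
    {r : ℝ} (hr0 : 0 ≤ r) (hr1 : r < 1) (hr : 1 - r ≤ (2 * M - 1) / (8 * M + 4))
    (hξξ : ‖ξ - ξ'‖ ≤ (2 * M - 1) / (8 * M + 4) * (1 - r)) :
    Metric.ball ((r : ℂ) * ξ) ((2 * M - 1) / (8 * M + 4) * (1 - r)) ⊆ nontangential M ξ' := by
  set δ := (2 * M - 1) / (8 * M + 4) with hδ
  have hδ0 : 0 < δ := div_pos (by linarith) (by linarith)
  have hδM : δ * (8 * M + 4) = 2 * M - 1 := div_mul_cancel₀ _ (by linarith)
  have hδ1 : δ < 1 / 4 := by rw [hδ, div_lt_iff₀ (by linarith)]; linarith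
  have hd : 0 < 1 - r := by linarith
  intro z hz
  rw [mem_ball_iff_norm] at hz
  have hrξ : ‖(r : ℂ) * ξ‖ = r := by
    rw [norm_mul, hξ, mul_one, Complex.norm_real, Real.norm_of_nonneg hr0]
  have h1 := abs_le.1 (abs_norm_sub_norm_le z ((r : ℂ) * ξ))
  rw [hrξ] at h1
  have hz1 : (1 - r) * (1 - δ) ≤ 1 - ‖z‖ := by nlinarith [h1.2]
  have hz2 : 2 * (1 - δ) ≤ 1 + ‖z‖ := by nlinarith [h1.1]
  have hzd : ‖z‖ < 1 := by nlinarith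
  refine ⟨mem_disc.2 hzd, ?_⟩
  have hr2 : ‖(r : ℂ) * ξ - ξ‖ = 1 - r := by
    have : (r : ℂ) * ξ - ξ = ((r - 1 : ℝ) : ℂ) * ξ := by push_cast; ring
    rw [this, norm_mul, hξ, mul_one, Complex.norm_real, Real.norm_eq_abs, abs_of_neg (by linarith)]
    ring
  have h2 : ‖z - ξ'‖ < (1 - r) * (1 + 2 * δ) := by
    have a1 := norm_sub_le_norm_sub_add_norm_sub z ((r : ℂ) * ξ) ξ'
    have a2 := norm_sub_le_norm_sub_add_norm_sub ((r : ℂ) * ξ) ξ ξ'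
    linarith
  have h3 : (1 - r) * (1 - δ) * (2 * (1 - δ)) ≤ 1 - ‖z‖ ^ 2 := by
    calc _ ≤ (1 - ‖z‖) * (1 + ‖z‖) :=
          mul_le_mul hz1 hz2 (by linarith) (by linarith)
      _ = _ := by ring
  have h4 : 1 + 2 * δ ≤ M * (2 * (1 - δ) ^ 2) := by nlinarith [mul_pos hδ0 hδ0]
  calc ‖z - ξ'‖ < (1 - r) * (1 + 2 * δ) := h2
    _ ≤ (1 - r) * (M * (2 * (1 - δ) ^ 2)) := mul_le_mul_of_nonneg_left h4 hd.le
    _ = M * ((1 - r) * (1 - δ) * (2 * (1 - δ))) := by ring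
    _ ≤ _ := mul_le_mul_of_nonneg_left h3 (by linarith)

/-- The part of a radial integral near the boundary is pointwise dominated by the conical integral
with the same vertex. -/
theorem radialInt_tail_le {M p : ℝ} (hM : 1 / 2 < M) {C : NNReal} {k₀ : ℕ}
    (hk₀ : (1 / 2 : ℝ) ^ k₀ ≤ (2 * M - 1) / (8 * M + 4)) {u : ℂ → ℝ≥0∞}
    (hmv : ∀ z ∈ disc, ENNReal.ofReal ((1 - ‖z‖) ^ 2) * u z ^ p ≤
      C * ∫⁻ w in Metric.ball z ((2 * M - 1) / (8 * M + 4) * (1 - ‖z‖)), u w ^ p) (t : ℝ) :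
    ∫⁻ r in Set.Ioo (1 - (1 / 2 : ℝ) ^ k₀) 1,
        u ((r : ℂ) * Complex.exp ((t : ℂ) * Complex.I)) ^ p ≤
      ENNReal.ofReal 16 * C * 3 * conicalInt M p u t := by
  set δ := (2 * M - 1) / (8 * M + 4) with hδ
  have hδ0 : 0 < δ := div_pos (by linarith) (by linarith)
  have hδ1 : δ ≤ 1 / 2 := by rw [hδ, div_le_iff₀ (by linarith)]; linarith
  set ξ := Complex.exp ((t : ℂ) * Complex.I) with hξ
  have hξ1 : ‖ξ‖ = 1 := Complex.norm_exp_ofReal_mul_I t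
  set ν := (volume : Measure ℂ).restrict (nontangential M ξ) with hν
  set W := fun k => wideLayer (fun z : ℂ => 1 - ‖z‖) k with hW
  set T := fun k => ∫⁻ z in W k, u z ^ p / ENNReal.ofReal (1 - ‖z‖ ^ 2) ∂ν with hT
  set L := fun k => dyadicLayer (fun r : ℝ => 1 - r) k ∩ Set.Ioo (1 - (1 / 2) ^ k₀) 1 with hL
  have hWm : ∀ k, MeasurableSet (W k) := fun k => measurableSet_wideLayer (by fun_prop) k
  have hcover : Set.Ioo (1 - (1 / 2 : ℝ) ^ k₀) 1 ⊆ ⋃ k, L k := by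
    intro r hr
    have h1 : (1 / 2 : ℝ) ^ k₀ ≤ 1 := pow_le_one₀ (by norm_num) (by norm_num)
    obtain ⟨k, hk⟩ := exists_mem_dyadicLayer (d := fun r : ℝ => 1 - r) (x := r)
      (by linarith [hr.2]) (by linarith [hr.1])
    exact Set.mem_iUnion.2 ⟨k, hk, hr⟩
  have hpt : ∀ k, ∀ r ∈ L k, u ((r : ℂ) * ξ) ^ p ≤
      ENNReal.ofReal (16 * 2 ^ k) * C * T k := by
    rintro k r ⟨⟨hk1, hk2⟩, hr⟩
    have hk3 : (1 / 2 : ℝ) ^ k₀ ≤ 1 := pow_le_one₀ (by norm_num) (by norm_num)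
    have hr0 : 0 ≤ r := by linarith [hr.1]
    have hrn : ‖(r : ℂ) * ξ‖ = r := norm_ofReal_mul_exp hr0 t
    have hrd : (r : ℂ) * ξ ∈ disc := mem_disc.2 (hrn.symm ▸ hr.2)
    have h := hmv _ hrd
    have hsub : Metric.ball ((r : ℂ) * ξ) (δ * (1 - r)) ⊆ nontangential M ξ :=
      ball_subset_nontangential hM hξ1 hr0 hr.2 (by linarith [hr.1])
        (by rw [sub_self, norm_zero]; exact mul_nonneg hδ0.le (by linarith [hr.2]))
    have e0 : (0 : ℝ) < (1 / 2) ^ k := by positivity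
    have e1 : (1 / 2 : ℝ) ^ (k + 1) = (1 / 2) ^ k / 2 := by rw [pow_succ]; ring
    have e2 : (1 / 2 : ℝ) ^ (k + 2) = (1 / 2) ^ k / 4 := by rw [pow_add]; ring
    rw [e1] at hk1
    have hwh : ∀ w ∈ Metric.ball ((r : ℂ) * ξ) (δ * (1 - r)),
        (1 - r) / 2 ≤ 1 - ‖w‖ ∧ 1 - ‖w‖ ≤ 3 / 2 * (1 - r) := by
      intro w hw
      have := mem_closedBall_whitney hδ1 hrd (w := w)
        (by rw [hrn]; exact Metric.ball_subset_closedBall hw)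
      rwa [hrn] at this
    have hsubW : Metric.ball ((r : ℂ) * ξ) (δ * (1 - r)) ⊆ W k := fun w hw =>
      ⟨by rw [e2]; linarith [(hwh w hw).1], by linarith [(hwh w hw).2]⟩
    rw [hrn] at h
    have hint : ∫⁻ w in Metric.ball ((r : ℂ) * ξ) (δ * (1 - r)), u w ^ p ≤
        ENNReal.ofReal (4 * (1 / 2) ^ k) * T k := by
      calc ∫⁻ w in Metric.ball ((r : ℂ) * ξ) (δ * (1 - r)), u w ^ p
          ≤ ∫⁻ w in Metric.ball ((r : ℂ) * ξ) (δ * (1 - r)),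
              ENNReal.ofReal (4 * (1 / 2) ^ k) * (u w ^ p / ENNReal.ofReal (1 - ‖w‖ ^ 2)) := by
            refine setLIntegral_mono' measurableSet_ball fun w hw => ?_
            obtain ⟨h1, h2⟩ := hwh w hw
            have hw1 : 0 < 1 - ‖w‖ ^ 2 := by nlinarith [norm_nonneg w, hr.2]
            rw [← mul_div_assoc, ENNReal.le_div_iff_mul_le
              (Or.inl (ENNReal.ofReal_pos.2 hw1).ne') (Or.inl ENNReal.ofReal_ne_top), mul_comm]
            refine mul_le_mul_left (ENNReal.ofReal_le_ofReal ?_) _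
            nlinarith [norm_nonneg w, hr.2]
        _ = ENNReal.ofReal (4 * (1 / 2) ^ k) *
              ∫⁻ w in Metric.ball ((r : ℂ) * ξ) (δ * (1 - r)),
                u w ^ p / ENNReal.ofReal (1 - ‖w‖ ^ 2) :=
            lintegral_const_mul' _ _ ENNReal.ofReal_ne_top
        _ ≤ _ := by
            rw [hT]
            simp only
            rw [hν, Measure.restrict_restrict (hWm k)]
            exact mul_le_mul_right (lintegral_mono_set (Set.subset_inter hsubW hsub)) _
    have hd : 1 ≤ ENNReal.ofReal (4 * (2 ^ k) ^ 2) * ENNReal.ofReal ((1 - r) ^ 2) := by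
      rw [← ENNReal.ofReal_mul (by positivity), ENNReal.one_le_ofReal]
      have h2 : (1 : ℝ) = 2 ^ k * (1 / 2) ^ k := by rw [← mul_pow]; norm_num
      have h3 : (1 : ℝ) ≤ 2 * 2 ^ k * (1 - r) := by
        have : (0 : ℝ) < 2 ^ k := by positivity
        nlinarith
      nlinarith
    calc u ((r : ℂ) * ξ) ^ p ≤ ENNReal.ofReal (4 * (2 ^ k) ^ 2) *
          (ENNReal.ofReal ((1 - r) ^ 2) * u ((r : ℂ) * ξ) ^ p) := by
          rw [← mul_assoc]; exact le_mul_of_one_le_left' hd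
      _ ≤ ENNReal.ofReal (4 * (2 ^ k) ^ 2) * (C * (ENNReal.ofReal (4 * (1 / 2) ^ k) * T k)) := by
          exact mul_le_mul_right (h.trans (mul_le_mul_right hint _)) _
      _ = (ENNReal.ofReal (4 * (2 ^ k) ^ 2) * ENNReal.ofReal (4 * (1 / 2) ^ k)) * C * T k := by
          ring
      _ = _ := by
          rw [← ENNReal.ofReal_mul (by positivity)]
          congr 3
          rw [one_div, inv_pow]; field_simp; norm_num
  have hLvol : ∀ k, volume (L k) ≤ ENNReal.ofReal ((1 / 2) ^ k) := by
    intro k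
    have hsub : L k ⊆ Set.Icc (1 - (1 / 2) ^ k) 1 := fun r hr =>
      ⟨by linarith [hr.1.2], hr.2.2.le⟩
    refine (measure_mono hsub).trans (le_of_eq ?_)
    rw [Real.volume_Icc]; congr 1; ring
  have hLm : ∀ k, MeasurableSet (L k) := fun k =>
    (measurableSet_dyadicLayer (by fun_prop) k).inter measurableSet_Ioo
  calc _ ≤ ∑' k, ∫⁻ r in L k, u ((r : ℂ) * ξ) ^ p :=
        (lintegral_mono_set hcover).trans (lintegral_iUnion_le _ _)
    _ ≤ ∑' k, ENNReal.ofReal 16 * C * T k := by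
        refine ENNReal.tsum_le_tsum fun k => ?_
        refine (setLIntegral_mono' (hLm k) (hpt k)).trans ?_
        rw [setLIntegral_const]
        refine (mul_le_mul_right (hLvol k) _).trans (le_of_eq ?_)
        have : ENNReal.ofReal (16 * 2 ^ k) * ENNReal.ofReal ((1 / 2) ^ k) = ENNReal.ofReal 16 := by
          rw [← ENNReal.ofReal_mul (by positivity)]
          congr 1
          rw [one_div, inv_pow]; field_simp
        rw [← this]; ring
    _ = ENNReal.ofReal 16 * C * ∑' k, T k := ENNReal.tsum_mul_left
    _ ≤ ENNReal.ofReal 16 * C * (3 * conicalInt M p u t) := by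
        gcongr
        exact tsum_setLIntegral_wideLayer_le (by fun_prop) ν _
    _ = _ := by ring

/-- A point `r ξ` close to the boundary is controlled by the conical integrals with vertices near
`ξ`. -/
theorem rpow_le_conicalInt {M p : ℝ} (hM : 1 / 2 < M) {C : NNReal} {u : ℂ → ℝ≥0∞}
    (hmv : ∀ z ∈ disc, ENNReal.ofReal ((1 - ‖z‖) ^ 2) * u z ^ p ≤
      C * ∫⁻ w in Metric.ball z ((2 * M - 1) / (8 * M + 4) * (1 - ‖z‖)), u w ^ p)
    {r : ℝ} (hr0 : 0 ≤ r) (hr1 : r < 1) (hr : 1 - r ≤ (2 * M - 1) / (8 * M + 4)) {ξ : ℂ}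
    (hξ : ‖ξ‖ = 1) {t : ℝ} (ht : ‖ξ - Complex.exp ((t : ℂ) * Complex.I)‖ ≤
      (2 * M - 1) / (8 * M + 4) * (1 - r)) :
    ENNReal.ofReal ((1 - r) ^ 2) * u ((r : ℂ) * ξ) ^ p ≤ C * conicalInt M p u t := by
  have hrn : ‖(r : ℂ) * ξ‖ = r := by
    rw [norm_mul, hξ, mul_one, Complex.norm_real, Real.norm_of_nonneg hr0]
  have h := hmv _ (mem_disc.2 (hrn.symm ▸ hr1))
  rw [hrn] at h
  have hsub := ball_subset_nontangential hM hξ hr0 hr1 hr ht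
  refine h.trans (mul_le_mul_right ?_ _)
  refine (setLIntegral_mono' measurableSet_ball fun w hw => ?_).trans (lintegral_mono_set hsub)
  have hw1 := mem_disc.1 (hsub hw).1
  rw [ENNReal.le_div_iff_mul_le
    (Or.inl (ENNReal.ofReal_pos.2 (by nlinarith [norm_nonneg w])).ne')
    (Or.inl ENNReal.ofReal_ne_top)]
  exact mul_le_of_le_one_right' (ENNReal.ofReal_le_one.2 (by nlinarith [sq_nonneg ‖w‖]))

/-- Within distance `η` of every point of the circle there is an arc whose parameters form a
subinterval of `(0, 2π)` of length `η`. -/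
theorem exists_Ioo_subset_norm_sub_exp_le {ξ : ℂ} (hξ : ‖ξ‖ = 1) {η : ℝ} (hη0 : 0 < η)
    (hη1 : η ≤ 1) :
    ∃ α : ℝ, Set.Ioo α (α + η) ⊆ Set.Ioo 0 (2 * Real.pi) ∧
      ∀ t ∈ Set.Ioo α (α + η), ‖ξ - Complex.exp ((t : ℂ) * Complex.I)‖ ≤ η := by
  have hpi := Real.pi_gt_three
  have hlip : ∀ a t : ℝ, ξ = Complex.exp ((a : ℂ) * Complex.I) →
      ‖ξ - Complex.exp ((t : ℂ) * Complex.I)‖ ≤ |a - t| := by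
    intro a t ha
    have e : ξ - Complex.exp ((t : ℂ) * Complex.I) = Complex.exp ((t : ℂ) * Complex.I) *
        (Complex.exp (Complex.I * ((a - t : ℝ) : ℂ)) - 1) := by
      rw [mul_sub, mul_one, ← Complex.exp_add, ha]
      congr 2; push_cast; ring
    rw [e, norm_mul, Complex.norm_exp_ofReal_mul_I, one_mul]
    exact Real.norm_exp_I_mul_ofReal_sub_one_le
  have harg : ξ = Complex.exp ((ξ.arg : ℂ) * Complex.I) := by
    have := Complex.norm_mul_exp_arg_mul_I ξ
    rw [hξ] at this
    simpa using this.symm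
  rcases le_or_gt 0 ξ.arg with h0 | h0
  · refine ⟨ξ.arg, fun t ht => ⟨lt_of_le_of_lt h0 ht.1, ?_⟩, fun t ht => ?_⟩
    · linarith [ht.2, Complex.arg_le_pi ξ]
    · refine (hlip _ t harg).trans ?_
      rw [abs_le]; constructor <;> linarith [ht.1, ht.2]
  · have harg' : ξ = Complex.exp (((ξ.arg + 2 * Real.pi : ℝ) : ℂ) * Complex.I) := by
      push_cast
      rw [add_mul, Complex.exp_add, ← harg, Complex.exp_two_pi_mul_I, mul_one]
    have h1 := Complex.neg_pi_lt_arg ξ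
    refine ⟨ξ.arg + 2 * Real.pi - η, fun t ht => ⟨?_, ?_⟩, fun t ht => ?_⟩
    · linarith [ht.1]
    · linarith [ht.2]
    · refine (hlip _ t harg').trans ?_
      rw [abs_le]; constructor <;> linarith [ht.1, ht.2]

/-- The radial integrals are controlled by the conical ones. -/
theorem exists_lintegral_radialInt_le {M p q : ℝ} (hM : 1 / 2 < M) (hp : 1 ≤ p) (hq : 1 ≤ q)
    (κ : ℕ) :
    ∃ C' : ℝ≥0∞, C' ≠ ⊤ ∧ ∀ g ∈ holo,
      ∫⁻ t, radialInt p (weightedSize κ g) t ^ (q / p) ∂circleMeasure ≤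
        C' * ∫⁻ t, conicalInt M p (weightedSize κ g) t ^ (q / p) ∂circleMeasure := by
  set δ := (2 * M - 1) / (8 * M + 4) with hδ
  have hδ0 : 0 < δ := div_pos (by linarith) (by linarith)
  have hδ1 : δ ≤ 1 / 2 := by rw [hδ, div_le_iff₀ (by linarith)]; linarith
  obtain ⟨C₀, hC₀⟩ := exists_weightedSize_rpow_half_le κ hδ0 hδ1
  obtain ⟨C, hC⟩ := exists_rpow_le_of_rpow_half_le C₀ hδ0 hp
  obtain ⟨k₀, hk₀⟩ := exists_pow_lt_of_lt_one hδ0 (by norm_num : (1 / 2 : ℝ) < 1)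
  set r₀ : ℝ := 1 - (1 / 2) ^ k₀ with hr₀
  have hd0 : (0 : ℝ) < (1 / 2) ^ k₀ := by positivity
  have hr₀0 : 0 < r₀ := by linarith
  have hr₀1 : r₀ < 1 := by linarith
  obtain ⟨C₁, hC₁⟩ := exists_norm_eq_weightedSize_le κ hr₀0 hr₀1
  have hs : 0 ≤ q / p := by positivity
  set η : ℝ := δ * (1 - r₀) with hη
  have hη0 : 0 < η := mul_pos hδ0 (by linarith)
  have hη1 : η ≤ 1 := by nlinarith
  set A : ℝ≥0∞ := ENNReal.ofReal 16 * C * 3 with hA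
  have hAt : A ≠ ⊤ := ENNReal.mul_ne_top
    (ENNReal.mul_ne_top ENNReal.ofReal_ne_top ENNReal.coe_ne_top) (by norm_num)
  set D : ℝ≥0∞ := (ENNReal.ofReal ((1 - r₀) ^ 2))⁻¹ * C with hD
  have hd2 : ENNReal.ofReal ((1 - r₀) ^ 2) ≠ 0 :=
    (ENNReal.ofReal_pos.2 (pow_pos (by linarith) 2)).ne'
  have hDt : D ≠ ⊤ := ENNReal.mul_ne_top (ENNReal.inv_ne_top.2 hd2) ENNReal.coe_ne_top
  set B : ℝ≥0∞ := (C₁ : ℝ≥0∞) ^ p with hB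
  have hBt : B ≠ ⊤ := ENNReal.rpow_ne_top_of_nonneg (by linarith) ENNReal.coe_ne_top
  have hηE : ENNReal.ofReal η ≠ 0 := (ENNReal.ofReal_pos.2 hη0).ne'
  set K : ℝ≥0∞ := B ^ (q / p) * (D ^ (q / p) * (ENNReal.ofReal η)⁻¹) *
    ENNReal.ofReal (2 * Real.pi) with hK
  refine ⟨2 ^ (q / p) * (A ^ (q / p) + K), ?_, fun g hg => ?_⟩
  · refine ENNReal.mul_ne_top (ENNReal.rpow_ne_top_of_nonneg hs (by norm_num))
      (ENNReal.add_ne_top.2 ⟨ENNReal.rpow_ne_top_of_nonneg hs hAt, ?_⟩)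
    refine ENNReal.mul_ne_top (ENNReal.mul_ne_top (ENNReal.rpow_ne_top_of_nonneg hs hBt)
      (ENNReal.mul_ne_top (ENNReal.rpow_ne_top_of_nonneg hs hDt) ?_)) ENNReal.ofReal_ne_top
    exact ENNReal.inv_ne_top.2 hηE
  set u := weightedSize κ g with hu
  have hum : Measurable u := measurable_weightedSize κ hg
  have hmv : ∀ z ∈ disc, ENNReal.ofReal ((1 - ‖z‖) ^ 2) * u z ^ p ≤
      C * ∫⁻ w in Metric.ball z (δ * (1 - ‖z‖)), u w ^ p := fun z hz =>
    hC u hum z hz (hC₀ g hg z hz)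
  obtain ⟨w₀, hw₀, hmax⟩ := hC₁ g hg
  set G := conicalInt M p u with hG
  set J := ∫⁻ t, G t ^ (q / p) ∂circleMeasure with hJ
  -- The central point `w₀` is seen from an arc of vertices of length bounded below.
  have hw₀J : (u w₀ ^ p) ^ (q / p) ≤ D ^ (q / p) * (ENNReal.ofReal η)⁻¹ * J := by
    set ξ : ℂ := w₀ / r₀ with hξ
    have hr₀c : (r₀ : ℂ) ≠ 0 := by exact_mod_cast hr₀0.ne'
    have hξ1 : ‖ξ‖ = 1 := by
      rw [hξ, norm_div, hw₀, Complex.norm_real, Real.norm_of_nonneg hr₀0.le, div_self hr₀0.ne']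
    have hw₀ξ : w₀ = (r₀ : ℂ) * ξ := by rw [hξ]; field_simp
    obtain ⟨α, hα, hclose⟩ := exists_Ioo_subset_norm_sub_exp_le hξ1 hη0 hη1
    have hpt : ∀ t ∈ Set.Ioo α (α + η), (u w₀ ^ p) ^ (q / p) ≤ D ^ (q / p) * G t ^ (q / p) := by
      intro t ht
      have h := rpow_le_conicalInt hM hmv hr₀0.le hr₀1 (by linarith) hξ1 (hclose t ht)
      rw [← hw₀ξ] at h
      rw [← ENNReal.mul_rpow_of_nonneg _ _ hs]
      refine ENNReal.rpow_le_rpow ?_ hs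
      rw [hD, mul_assoc]
      rw [mul_comm, ← div_eq_mul_inv, ENNReal.le_div_iff_mul_le (Or.inl hd2)
        (Or.inl ENNReal.ofReal_ne_top), mul_comm]
      exact h
    have hint : (u w₀ ^ p) ^ (q / p) * ENNReal.ofReal η ≤ D ^ (q / p) * J := by
      calc (u w₀ ^ p) ^ (q / p) * ENNReal.ofReal η
          = ∫⁻ t in Set.Ioo α (α + η), (u w₀ ^ p) ^ (q / p) := by
            rw [setLIntegral_const, Real.volume_Ioo, add_sub_cancel_left]
        _ ≤ ∫⁻ t in Set.Ioo α (α + η), D ^ (q / p) * G t ^ (q / p) :=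
            setLIntegral_mono' measurableSet_Ioo hpt
        _ ≤ ∫⁻ t, D ^ (q / p) * G t ^ (q / p) ∂circleMeasure := lintegral_mono_set hα
        _ = _ := lintegral_const_mul' _ _ (ENNReal.rpow_ne_top_of_nonneg hs hDt)
    rw [mul_right_comm, ← div_eq_mul_inv]
    rwa [ENNReal.le_div_iff_mul_le (Or.inl hηE) (Or.inl ENNReal.ofReal_ne_top)]
  have hrad : ∀ t, radialInt p u t ≤ A * G t + B * u w₀ ^ p := by
    intro t
    have hsub : Set.Ioo (0 : ℝ) 1 ⊆ Set.Ioo r₀ 1 ∪ Set.Ioc 0 r₀ := by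
      intro r hr
      rcases lt_or_ge r₀ r with h | h
      · exact Or.inl ⟨h, hr.2⟩
      · exact Or.inr ⟨hr.1, h⟩
    refine (lintegral_mono_set hsub).trans ((lintegral_union_le _ _ _).trans (add_le_add ?_ ?_))
    · exact radialInt_tail_le hM hk₀.le hmv t
    · calc _ ≤ ∫⁻ r in Set.Ioc (0 : ℝ) r₀, B * u w₀ ^ p := by
            refine setLIntegral_mono' measurableSet_Ioc fun r hr => ?_
            rw [hB, ← ENNReal.mul_rpow_of_nonneg _ _ (by linarith)]
            refine ENNReal.rpow_le_rpow (hmax _ ?_) (by linarith)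
            rw [norm_ofReal_mul_exp hr.1.le]; exact hr.2
        _ ≤ _ := by
            rw [setLIntegral_const, Real.volume_Ioc, sub_zero]
            exact mul_le_of_le_one_right' (ENNReal.ofReal_le_one.2 hr₀1.le)
  calc ∫⁻ t, radialInt p u t ^ (q / p) ∂circleMeasure
      ≤ ∫⁻ t, 2 ^ (q / p) * (A ^ (q / p) * G t ^ (q / p) +
          B ^ (q / p) * (u w₀ ^ p) ^ (q / p)) ∂circleMeasure := by
        refine lintegral_mono fun t => (ENNReal.rpow_le_rpow (hrad t) hs).trans ?_
        rw [← ENNReal.mul_rpow_of_nonneg _ _ hs, ← ENNReal.mul_rpow_of_nonneg _ _ hs]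
        exact add_rpow_le_two_rpow_mul _ _ hs
    _ = 2 ^ (q / p) * (A ^ (q / p) * J +
          B ^ (q / p) * (u w₀ ^ p) ^ (q / p) * ENNReal.ofReal (2 * Real.pi)) := by
        rw [lintegral_const_mul' _ _ (ENNReal.rpow_ne_top_of_nonneg hs (by norm_num)),
          lintegral_add_right _ measurable_const,
          lintegral_const_mul' _ _ (ENNReal.rpow_ne_top_of_nonneg hs hAt), lintegral_const]
        congr 3
        rw [circleMeasure, Measure.restrict_apply_univ, Real.volume_Ioo, sub_zero]
    _ ≤ 2 ^ (q / p) * (A ^ (q / p) * J +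
          B ^ (q / p) * (D ^ (q / p) * (ENNReal.ofReal η)⁻¹ * J) *
            ENNReal.ofReal (2 * Real.pi)) := by gcongr
    _ = _ := by rw [hK]; ring

/-! ### Comparison of the norms -/

/-- The norm `ρ_{p,q}` in terms of `weightedSize`, which is measurable on the whole plane. -/
theorem rho_eq (p q : ℝ) (κ : ℕ) (g : ℂ → ℂ) :
    rho p q (fun z => g z * (((1 - ‖z‖) ^ κ : ℝ) : ℂ)) = ((ENNReal.ofReal (2 * Real.pi))⁻¹ *
      ∫⁻ t, radialInt p (weightedSize κ g) t ^ (q / p) ∂circleMeasure) ^ (1 / q) := by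
  unfold rho circleMeasure radialInt
  congr 3
  ext t
  congr 1
  refine setLIntegral_congr_fun measurableSet_Ioo fun r hr => ?_
  have hd : (r : ℂ) * Complex.exp ((t : ℂ) * Complex.I) ∈ disc := by
    rw [mem_disc, norm_ofReal_mul_exp hr.1.le]; exact hr.2
  simp only [weightedSize, Set.indicator_of_mem hd]

theorem tentNorm_eq (M p q : ℝ) (κ : ℕ) (g : ℂ → ℂ) :
    tentNorm M p q 1 (fun z => g z * (((1 - ‖z‖) ^ κ : ℝ) : ℂ)) =
      (∫⁻ t, conicalInt M p (weightedSize κ g) t ^ (q / p) ∂circleMeasure) ^ (1 / q) := by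
  unfold tentNorm circleMeasure conicalInt
  congr 2
  ext t
  congr 1
  have hm : MeasurableSet (nontangential M (Complex.exp ((t : ℂ) * Complex.I))) :=
    measurableSet_ball.inter (measurableSet_lt
      (by fun_prop : Measurable fun z : ℂ => ‖z - Complex.exp ((t : ℂ) * Complex.I)‖)
      (by fun_prop : Measurable fun z : ℂ => M * (1 - ‖z‖ ^ 2)))
  refine setLIntegral_congr_fun hm fun z hz => ?_
  have e : (2 : ℝ) - 1 = 1 := by norm_num
  simp only [weightedSize, Set.indicator_of_mem hz.1, e, Real.rpow_one]

/-- The two norms are comparable on holomorphic functions with a power weight. -/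
theorem exists_rho_le_and_tentNorm_le {M p q : ℝ} (hM : 1 / 2 < M) (hp : 1 ≤ p) (hq : 1 ≤ q)
    (κ : ℕ) :
    ∃ C : NNReal, 0 < C ∧ ∀ g ∈ holo,
      rho p q (fun z => g z * (((1 - ‖z‖) ^ κ : ℝ) : ℂ)) ≤
        C * tentNorm M p q 1 (fun z => g z * (((1 - ‖z‖) ^ κ : ℝ) : ℂ)) ∧
      tentNorm M p q 1 (fun z => g z * (((1 - ‖z‖) ^ κ : ℝ) : ℂ)) ≤
        C * rho p q (fun z => g z * (((1 - ‖z‖) ^ κ : ℝ) : ℂ)) := by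
  obtain ⟨A, hA, hAle⟩ := exists_lintegral_radialInt_le hM hp hq κ
  obtain ⟨C₀, hC₀⟩ := exists_weightedSize_rpow_half_le κ (δ := 1 / 2) (by norm_num) le_rfl
  obtain ⟨B, hB, hBle⟩ := exists_lintegral_conicalInt_le (M := M) (by linarith) hp hq C₀
  have hq0 : 0 ≤ 1 / q := by positivity
  set τ := ENNReal.ofReal (2 * Real.pi) with hτ
  have hτ0 : τ ≠ 0 := (ENNReal.ofReal_pos.2 Real.two_pi_pos).ne'
  have hτt : τ ≠ ⊤ := ENNReal.ofReal_ne_top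
  have hC1 : (τ⁻¹ * A) ^ (1 / q) ≠ ⊤ := ENNReal.rpow_ne_top_of_nonneg hq0
    (ENNReal.mul_ne_top (ENNReal.inv_ne_top.2 hτ0) hA)
  have hC2 : (B * τ) ^ (1 / q) ≠ ⊤ := ENNReal.rpow_ne_top_of_nonneg hq0
    (ENNReal.mul_ne_top hB hτt)
  refine ⟨((τ⁻¹ * A) ^ (1 / q)).toNNReal + ((B * τ) ^ (1 / q)).toNNReal + 1, by positivity,
    fun g hg => ?_⟩
  rw [rho_eq, tentNorm_eq]
  set R := ∫⁻ t, radialInt p (weightedSize κ g) t ^ (q / p) ∂circleMeasure with hR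
  set G := ∫⁻ t, conicalInt M p (weightedSize κ g) t ^ (q / p) ∂circleMeasure with hG
  push_cast
  rw [ENNReal.coe_toNNReal hC1, ENNReal.coe_toNNReal hC2]
  constructor
  · calc (τ⁻¹ * R) ^ (1 / q) ≤ (τ⁻¹ * (A * G)) ^ (1 / q) := by
          gcongr; exact hAle g hg
      _ = (τ⁻¹ * A) ^ (1 / q) * G ^ (1 / q) := by
          rw [← mul_assoc, ENNReal.mul_rpow_of_nonneg _ _ hq0]
      _ ≤ _ := by
          gcongr
          rw [add_assoc]; exact le_self_add
  · calc G ^ (1 / q) ≤ (B * R) ^ (1 / q) := by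
          gcongr; exact hBle _ (measurable_weightedSize κ hg) (hC₀ g hg)
      _ = (B * τ) ^ (1 / q) * (τ⁻¹ * R) ^ (1 / q) := by
          rw [← ENNReal.mul_rpow_of_nonneg _ _ hq0, mul_assoc, ← mul_assoc τ,
            ENNReal.mul_inv_cancel hτ0 hτt, one_mul]
      _ ≤ _ := by
          gcongr
          rw [add_right_comm]; exact le_add_self

end RadialTent

theorem proposition3p1 (M p q : ℝ) (hM : 1 / 2 < M) (hp : 1 ≤ p) (hq : 1 ≤ q) :
    (∃ C : NNReal, 0 < C ∧ ∀ f ∈ RadialTent.holo,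
      RadialTent.rho p q f ≤ C * RadialTent.tentNorm M p q 1 f ∧
      RadialTent.tentNorm M p q 1 f ≤ C * RadialTent.rho p q f) ∧
    (∃ C : NNReal, 0 < C ∧ ∀ f ∈ RadialTent.holo,
      RadialTent.rho p q (RadialTent.weightedDeriv f) ≤
        C * RadialTent.tentNorm M p q 1 (RadialTent.weightedDeriv f) ∧
      RadialTent.tentNorm M p q 1 (RadialTent.weightedDeriv f) ≤
        C * RadialTent.rho p q (RadialTent.weightedDeriv f)) ∧
    RadialTent.RM p q = RadialTent.analyticTentSpace M p q 1 := by
  obtain ⟨C, hC0, hC⟩ := RadialTent.exists_rho_le_and_tentNorm_le hM hp hq 0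
  obtain ⟨C', hC0', hC'⟩ := RadialTent.exists_rho_le_and_tentNorm_le hM hp hq 1
  simp only [pow_zero, Complex.ofReal_one, mul_one] at hC
  simp only [pow_one] at hC'
  refine ⟨⟨C, hC0, hC⟩, ⟨C', hC0', fun f hf => ?_⟩, ?_⟩
  · exact hC' (deriv f) (DifferentiableOn.deriv hf Metric.isOpen_ball)
  · ext f
    constructor
    · rintro ⟨hf, hfin⟩
      refine ⟨⟨?_, (hC f hf).2.trans_lt (ENNReal.mul_lt_top ENNReal.coe_lt_top hfin)⟩, hf⟩
      exact (continuousOn_iff_continuous_domRestrict.1 (DifferentiableOn.continuousOn hf)).measurable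
    · rintro ⟨⟨_, hfin⟩, hf⟩
      exact ⟨hf, (hC f hf).1.trans_lt (ENNReal.mul_lt_top ENNReal.coe_lt_top hfin)⟩
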